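/- A geometric graph is a finite simple graph drawn in the plane with its vertices at distinct points, no three of them collinear, and its edges as straight-line segments, such that two distinct edges meet at most in a common endpoint (noncrossing). A compatible matching of a geometric graph $G$ is a (possibly empty) set $M$ of pairwise vertex-disjoint straight-line edges between vertices of $G$, none of them an edge of $G$, such that $G+M$ is again noncrossing. It is maximal if it is not properly contained in another compatible matching of $G$. Let $\mathrm{mm}(G)$ denote the minimum number of edges of a maximal compatible matching of $G$. **Theorem.** Let $G$ be an $n$-vertex geometric graph. (a) If $G$ is $0$-regular (a point set), then $\mathrm{mm}(G)\ge \frac{n-1}{3}$. (b) If $G$ is $1$-regular (a perfect matching), then $\mathrm{mm}(G)\ge \frac{n-2}{6}$. (c) If $G$ is $2$-regular (disjoint polygons), then $\mathrm{mm}(G)\ge \frac{n-3}{11}$. Each of these bounds is tight for infinitely many $n$: there are infinitely many $n$ for which some $n$-vertex $0$-regular geometric graph $G$ has $\mathrm{mm}(G)=\frac{n-1}{3}$, infinitely many $n$ for which some $n$-vertex $1$-regular one has $\mathrm{mm}(G)=\frac{n-2}{6}$, and infinitely many $n$ for which some $n$-vertex $2$-regular one has $\mathrm{mm}(G)=\frac{n-3}{11}$.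 -/

import Mathlib

/-- Straight-line drawing of `H` with vertex `v` placed at `p v` is noncrossing: two distinct edges
meet at most in the images of their common endpoints. -/
def IsNoncrossing {V : Type*} (p : V → ℝ × ℝ) (H : SimpleGraph V) : Prop :=
  ∀ u v x y : V, H.Adj u v → H.Adj x y → s(u, v) ≠ s(x, y) →
    segment ℝ (p u) (p v) ∩ segment ℝ (p x) (p y) ⊆ p '' (({u, v} : Set V) ∩ {x, y})

/-- A noncrossing geometric (straight-line) graph in the plane with vertices in general position.
The plane is written `ℝ × ℝ`: only its affine structure is used. -/
structure GeometricGraph (V : Type*) where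
  pos : V → ℝ × ℝ
  graph : SimpleGraph V
  pos_injective : Function.Injective pos
  general_position : ∀ u v w : V, u ≠ v → v ≠ w → u ≠ w →
    ¬ Collinear ℝ ({pos u, pos v, pos w} : Set (ℝ × ℝ))
  noncrossing : IsNoncrossing pos graph

namespace GeometricGraph

/-- `M` is a compatible matching of `G`: a matching on the vertices of `G` (every vertex has at
most one partner), using no edge of `G`, such that the drawing of `G + M` is noncrossing. -/
structure IsCompatibleMatching {V : Type*} (G : GeometricGraph V) (M : SimpleGraph V) : Prop where
  matching : ∀ v a b : V, M.Adj v a → M.Adj v b → a = b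
  disjoint : Disjoint G.graph M
  noncrossing : IsNoncrossing G.pos (G.graph ⊔ M)

/-- A compatible matching not properly contained in another compatible matching. -/
def IsMaximalCompatibleMatching {V : Type*} (G : GeometricGraph V) (M : SimpleGraph V) : Prop :=
  Maximal G.IsCompatibleMatching M

/-- The least number of edges of a maximal compatible matching of `G`. -/
noncomputable def mm {V : Type*} (G : GeometricGraph V) : ℕ :=
  sInf {k : ℕ | ∃ M : SimpleGraph V, G.IsMaximalCompatibleMatching M ∧ M.edgeSet.ncard = k}

open Classical in
/-- `G` is `d`-regular as an abstract graph. -/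
def IsRegular {V : Type*} [Fintype V] (G : GeometricGraph V) (d : ℕ) : Prop :=
  G.graph.IsRegularOfDegree d

/-- On finitely many vertices `mm` is attained, so the infimum in its definition is a minimum. -/
theorem exists_mm_eq {V : Type*} [Finite V] (G : GeometricGraph V) :
    ∃ M : SimpleGraph V, G.IsMaximalCompatibleMatching M ∧ M.edgeSet.ncard = G.mm := by
  have h0 : G.IsCompatibleMatching ⊥ :=
    ⟨fun _ _ _ h => h.elim, disjoint_bot_right, by simpa using G.noncrossing⟩
  obtain ⟨M, hM⟩ := (Set.toFinite {M | G.IsCompatibleMatching M}).exists_maximal ⟨⊥, h0⟩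
  exact Nat.sInf_mem
    (s := {k : ℕ | ∃ M, G.IsMaximalCompatibleMatching M ∧ M.edgeSet.ncard = k}) ⟨_, M, hM, rfl⟩

end GeometricGraph

/-!
Let `M` be a maximal compatible matching of a `d`-regular drawing `G`, with `d ≤ 2`. Extending the
edges of `G + M` one after another until they hit something cuts the plane into at most `|E(G+M)|+1`
convex cells, and a vertex of degree `δ` lies on the boundary of more than `min δ 2` of them. By
maximality the unmatched vertices on the boundary of one cell are pairwise adjacent in `G`, so there
are at most `d + 1` of them, and double counting the incidences between unmatched vertices and cells
gives the bounds. For `d = 2` the cells meeting three unmatched vertices correspond to distinct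
triangles of `G`, so there are at most a third as many of them as unmatched vertices, and all other
cells meet at most two.

For tightness, take a perfectly matched drawing with marked slots such that the edges separate any
two slots. Putting a small copy of a drawing whose unmatched vertices already block each other into
every slot and repeating gives arbitrarily large examples. All conditions are open, so the points
can be moved into general position.
-/

open Set Filter Topology

section Visibility

variable {E : Type*} [AddCommGroup E] [Module ℝ E] {X C : Set E} {p q r : E}

/-- Two points see each other past the obstacle `X` if the segment between them avoids `X`. -/
def Visible (X : Set E) (p q : E) : Prop := Disjoint (segment ℝ p q) X

namespace Visible

lemma symm (h : Visible X p q) : Visible X q p := by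
  rwa [Visible, segment_symm]

lemma left_notMem (h : Visible X p q) : p ∉ X :=
  disjoint_left.1 h (left_mem_segment ℝ p q)

lemma right_notMem (h : Visible X p q) : q ∉ X :=
  h.symm.left_notMem

lemma of_convex (hC : Convex ℝ C) (hCX : Disjoint C X) (hp : p ∈ C) (hq : q ∈ C) :
    Visible X p q :=
  hCX.mono_left (hC.segment_subset hp hq)

lemma lineMap_notMem (h : Visible X p q) {t : ℝ} (ht : t ∈ Icc (0 : ℝ) 1) :
    AffineMap.lineMap p q t ∉ X := by
  refine disjoint_left.1 h ?_
  rw [segment_eq_image_lineMap]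
  exact mem_image_of_mem _ ht

end Visible

lemma visible_self (h : p ∉ X) : Visible X p p := by
  simpa [Visible] using h

lemma exists_lineMap_mem_of_not_visible (h : ¬ Visible X p q) :
    ∃ t ∈ Icc (0 : ℝ) 1, AffineMap.lineMap p q t ∈ X := by
  obtain ⟨z, hz, hzX⟩ := not_disjoint_iff.1 h
  rw [segment_eq_image_lineMap] at hz
  obtain ⟨t, ht, rfl⟩ := hz
  exact ⟨t, ht, hzX⟩

lemma Visible.exists_first_blocked [TopologicalSpace E] [IsTopologicalAddGroup E]
    [ContinuousSMul ℝ E] (hX : IsClosed X) (hpq : Visible X p q) (hpr : ¬ Visible X p r) :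
    ∃ t ∈ Ioc (0 : ℝ) 1, ¬ Visible X p (AffineMap.lineMap q r t) ∧
      ∀ t' ∈ Ico 0 t, Visible X p (AffineMap.lineMap q r t') := by
  let F : ℝ × ℝ → E := fun a => AffineMap.lineMap p (AffineMap.lineMap q r a.1) a.2
  have hF : Continuous F := by
    simp only [F, AffineMap.lineMap_apply_module']
    fun_prop
  let K : Set (ℝ × ℝ) := (Icc 0 1 ×ˢ Icc 0 1) ∩ F ⁻¹' X
  have hK : IsCompact K := (isCompact_Icc.prod isCompact_Icc).inter_right (hX.preimage hF)
  have hmemK : ∀ t ∈ Icc (0 : ℝ) 1, ¬ Visible X p (AffineMap.lineMap q r t) →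
      t ∈ Prod.fst '' K := by
    intro t ht hvis
    obtain ⟨s, hs, hsX⟩ := exists_lineMap_mem_of_not_visible hvis
    exact ⟨(t, s), ⟨⟨ht, hs⟩, hsX⟩, rfl⟩
  have hne : (Prod.fst '' K).Nonempty := ⟨1, hmemK 1 (by simp) (by simpa using hpr)⟩
  obtain ⟨_, ⟨⟨t, s⟩, ⟨⟨ht, hs⟩, hsX⟩, rfl⟩, hmin⟩ :=
    (hK.image continuous_fst).exists_isLeast hne
  simp only at ht hs hmin
  refine ⟨t, ⟨ht.1.lt_of_ne ?_, ht.2⟩, fun h => h.lineMap_notMem hs hsX, fun t' ht' => ?_⟩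
  · rintro rfl
    exact hpq.lineMap_notMem hs (by simpa [F] using hsX)
  · by_contra hvis
    exact absurd (hmin (hmemK t' ⟨ht'.1, ht'.2.le.trans ht.2⟩ hvis)) (not_le.2 ht'.2)

end Visibility

section Line

variable (l : ℝ →ᵃ[ℝ] ℝ)

/-- Signed vertical distance of a point of the plane from the graph of `l`. Nonvertical lines are
encoded as affine functions throughout. -/
def height : ℝ × ℝ →ᵃ[ℝ] ℝ := AffineMap.snd - l.comp AffineMap.fst

lemma height_apply (z : ℝ × ℝ) : height l z = z.2 - l z.1 := rfl

lemma height_mk_add (x h : ℝ) : height l (x, l x + h) = h := by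
  simp [height_apply]

lemma height_eq_zero_iff {z : ℝ × ℝ} : height l z = 0 ↔ z.2 = l z.1 := sub_eq_zero

lemma continuous_height : Continuous (height l) :=
  (height l).continuous_of_finiteDimensional

/-- The open side of the graph of `l` on which `height l` has the sign of `κ`. -/
def halfPlane (κ : ℝ) : Set (ℝ × ℝ) := {w | 0 < κ * height l w}

lemma isOpen_halfPlane (κ : ℝ) : IsOpen (halfPlane l κ) :=
  isOpen_lt continuous_const (continuous_const.mul (continuous_height l))

lemma convex_halfPlane (κ : ℝ) : Convex ℝ (halfPlane l κ) :=
  (convex_Ioi 0).affine_preimage (κ • height l)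

/-- The slope of the graph of `l`. -/
def lineSlope : ℝ := l.linear 1

lemma apply_eq_add_lineSlope (x₀ x : ℝ) : l x = l x₀ + lineSlope l * (x - x₀) := by
  have hlin : l x - l x₀ = l.linear ((x - x₀) • 1) := by
    simpa using (l.linearMap_vsub x x₀).symm
  rw [map_smul, smul_eq_mul] at hlin
  rw [lineSlope]
  linarith

variable {l} {m : ℝ →ᵃ[ℝ] ℝ} {z : ℝ × ℝ} {κ τ : ℝ}

lemma lineSlope_ne_of_apply_eq (hlm : l ≠ m) {x : ℝ} (hx : l x = m x) :
    lineSlope l ≠ lineSlope m := by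
  intro h
  refine hlm (AffineMap.ext fun y => ?_)
  rw [apply_eq_add_lineSlope l x, apply_eq_add_lineSlope m x, hx, h]

lemma eq_of_apply_eq_of_ne {x y : ℝ} (hx : l x = m x) (hy : l y = m y) (hxy : x ≠ y) : l = m := by
  by_contra hlm
  rw [apply_eq_add_lineSlope l x, apply_eq_add_lineSlope m x, hx, add_right_inj] at hy
  exact lineSlope_ne_of_apply_eq hlm hx (mul_right_cancel₀ (sub_ne_zero.2 hxy.symm) hy)

lemma height_add_smul (l : ℝ →ᵃ[ℝ] ℝ) (z d : ℝ × ℝ) (t : ℝ) :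
    height l (z + t • d) = height l z + t * (d.2 - lineSlope l * d.1) := by
  rw [height_apply, height_apply, apply_eq_add_lineSlope l z.1]
  simp only [Prod.fst_add, Prod.snd_add, Prod.smul_fst, Prod.smul_snd, smul_eq_mul]
  ring

lemma mem_closure_of_forall_add_smul_mem {R : Set (ℝ × ℝ)} (d : ℝ × ℝ)
    (h : ∀ t : ℝ, 0 < t → z + t • d ∈ R) : z ∈ closure R := by
  have hcont : Continuous fun t : ℝ => z + t • d := by fun_prop
  have h0 : (0 : ℝ) ∈ closure (Ioi (0 : ℝ)) := by
    rw [closure_Ioi]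
    exact self_mem_Ici
  simpa using map_mem_closure hcont h0 h

lemma mem_closure_halfPlane (hκ : κ ≠ 0) (hz : height l z = 0) : z ∈ closure (halfPlane l κ) := by
  refine mem_closure_of_forall_add_smul_mem (0, κ) fun t ht => ?_
  have : 0 < t * (κ * κ) := mul_pos ht (mul_self_pos.2 hκ)
  simp only [halfPlane, mem_ofPred_eq, height_add_smul, hz]
  linarith

lemma mem_closure_inter_halfPlane (hlm : l ≠ m) (hl : height l z = 0) (hm : height m z = 0)
    (hκ : κ ≠ 0) (hτ : τ ≠ 0) : z ∈ closure (halfPlane l κ ∩ halfPlane m τ) := by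
  have hσ : lineSlope l - lineSlope m ≠ 0 := sub_ne_zero.2 (lineSlope_ne_of_apply_eq hlm
    (((height_eq_zero_iff l).1 hl).symm.trans ((height_eq_zero_iff m).1 hm)))
  -- the direction in which the two heights grow at rates `κ` and `τ`
  let d : ℝ × ℝ :=
    ((τ - κ) / (lineSlope l - lineSlope m),
      κ + lineSlope l * ((τ - κ) / (lineSlope l - lineSlope m)))
  have hdl : d.2 - lineSlope l * d.1 = κ := by simp only [d]; ring
  have hdm : d.2 - lineSlope m * d.1 = τ := by simp only [d]; field_simp; ring
  refine mem_closure_of_forall_add_smul_mem d fun t ht => ?_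
  have hκ2 : 0 < t * (κ * κ) := mul_pos ht (mul_self_pos.2 hκ)
  have hτ2 : 0 < t * (τ * τ) := mul_pos ht (mul_self_pos.2 hτ)
  simp only [halfPlane, mem_inter_iff, mem_ofPred_eq, height_add_smul, hl, hm, hdl, hdm]
  constructor <;> linarith

lemma notMem_closure_inter_halfPlane_neg {C : Set (ℝ × ℝ)} (hC : Convex ℝ C)
    (hmiss : ∀ᶠ w in 𝓝 z, w ∈ C → height l w ≠ 0) (hz : z ∈ closure (C ∩ halfPlane l κ)) :
    z ∉ closure (C ∩ halfPlane l (-κ)) := by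
  intro hz'
  obtain ⟨ε, hε, hball⟩ := Metric.eventually_nhds_iff_ball.1 hmiss
  obtain ⟨a, ha, haC, ha0⟩ := mem_closure_iff.1 hz _ Metric.isOpen_ball (Metric.mem_ball_self hε)
  obtain ⟨b, hb, hbC, hb0⟩ := mem_closure_iff.1 hz' _ Metric.isOpen_ball (Metric.mem_ball_self hε)
  simp only [halfPlane, mem_ofPred_eq, neg_mul, neg_pos] at ha0 hb0
  obtain ⟨w, hw, hw0⟩ := (convex_segment a b).isPreconnected.intermediate_value
    (right_mem_segment ℝ a b) (left_mem_segment ℝ a b) (f := fun w => κ * height l w)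
    (continuous_const.mul (continuous_height l)).continuousOn ⟨hb0.le, ha0.le⟩
  refine hball w ((convex_ball z ε).segment_subset ha hb hw) (hC.segment_subset haC hbC hw) ?_
  exact (mul_eq_zero.1 hw0).resolve_left (left_ne_zero_of_mul ha0.ne')

end Line

lemma eventually_mem_of_mem_closure {D : Set ℝ} (hD : D.OrdConnected) {x₀ c : ℝ}
    (hx₀ : x₀ ∈ closure D) (hc : c ∈ D) : ∀ᶠ x in 𝓝 x₀, 0 < (x - x₀) * (c - x₀) → x ∈ D := by
  rcases lt_trichotomy c x₀ with hlt | rfl | hgt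
  · filter_upwards [eventually_gt_nhds hlt] with x hx hpos
    have hxx₀ : x < x₀ := by nlinarith
    obtain ⟨y, hy, hyD⟩ := mem_closure_iff.1 hx₀ _ isOpen_Ioi hxx₀
    exact hD.out hc hyD ⟨hx.le, le_of_lt hy⟩
  · simp
  · filter_upwards [eventually_lt_nhds hgt] with x hx hpos
    have hxx₀ : x₀ < x := by nlinarith
    obtain ⟨y, hy, hyD⟩ := mem_closure_iff.1 hx₀ _ isOpen_Iio hxx₀
    exact hD.out hyD hc ⟨le_of_lt hy, hx.le⟩

/-- The family `C` is a partition of `Y` into convex (possibly empty) sets. -/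
structure IsConvexPartition {E K : Type*} [AddCommGroup E] [Module ℝ E] (Y : Set E)
    (C : K → Set E) : Prop where
  convex : ∀ k, Convex ℝ (C k)
  disjoint : Pairwise fun k l => Disjoint (C k) (C l)
  iUnion_eq : ⋃ k, C k = Y

lemma IsConvexPartition.subset {E K : Type*} [AddCommGroup E] [Module ℝ E] {Y : Set E}
    {C : K → Set E} (hC : IsConvexPartition Y C) (k : K) : C k ⊆ Y :=
  hC.iUnion_eq ▸ subset_iUnion C k

lemma finite_and_card_le_of_forall_const {K ι : Type*} [Finite ι] (a b : ι → K)
    (h : ∀ f : K → Prop, (∀ i, f (a i) ↔ f (b i)) → ∀ k l, f k → f l) :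
    Finite K ∧ Nat.card K ≤ Nat.card ι + 1 := by
  rcases isEmpty_or_nonempty K with hK | ⟨⟨k₀⟩⟩
  · exact ⟨inferInstance, by simp⟩
  have hfinite : Finite K := by
    have hA : ({k₀} ∪ range a ∪ range b : Set K).Finite :=
      ((finite_singleton k₀).union (finite_range a)).union (finite_range b)
    exact finite_univ_iff.1 (hA.subset fun l _ =>
      h (· ∈ ({k₀} ∪ range a ∪ range b : Set K)) (fun i => by simp) k₀ l (by simp))
  refine ⟨hfinite, ?_⟩
  let Γ : SimpleGraph K := SimpleGraph.fromEdgeSet (range fun i => s(a i, b i))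
  have hreach : ∀ i, Γ.Reachable (a i) (b i) := by
    intro i
    by_cases hab : a i = b i
    · rw [hab]
    · exact SimpleGraph.Adj.reachable
        ((SimpleGraph.fromEdgeSet_adj _).2 ⟨mem_range_self i, hab⟩)
  have hconn : Γ.Connected := by
    have : Nonempty K := ⟨k₀⟩
    refine SimpleGraph.Connected.mk fun k l => ?_
    exact h (Γ.Reachable k) (fun i => ⟨fun h => h.trans (hreach i), fun h =>
      h.trans (hreach i).symm⟩) k l (SimpleGraph.Reachable.refl k)
  have hedges : Γ.edgeSet ⊆ range fun i => s(a i, b i) := by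
    rw [SimpleGraph.edgeSet_fromEdgeSet]
    exact sdiff_subset
  calc Nat.card K ≤ Nat.card Γ.edgeSet + 1 := hconn.card_vert_le_card_edgeSet_add_one
    _ ≤ Nat.card (range fun i => s(a i, b i)) + 1 :=
      Nat.add_le_add_right (Nat.card_mono (finite_range _) hedges) 1
    _ ≤ Nat.card ι + 1 := Nat.add_le_add_right (Finite.card_range_le _) 1

/-- A family of pairwise disjoint relatively open pieces of distinct nonvertical lines: piece `i`
is the part of the graph of `ℓ i` over the open interval `dom i`, which may be unbounded. -/
structure SegmentSystem {ι : Type*} (ℓ : ι ↪ (ℝ →ᵃ[ℝ] ℝ)) where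
  dom : ι → Set ℝ
  isOpen_dom : ∀ i, IsOpen (dom i)
  ordConnected_dom : ∀ i, (dom i).OrdConnected
  nonempty_dom : ∀ i, (dom i).Nonempty
  apply_ne : ∀ i j x, i ≠ j → x ∈ dom i → x ∈ dom j → ℓ i x ≠ ℓ j x

namespace SegmentSystem

variable {ι : Type*} {ℓ : ι ↪ (ℝ →ᵃ[ℝ] ℝ)}

instance : Preorder (SegmentSystem ℓ) := Preorder.lift dom

section Basic

variable (S : SegmentSystem ℓ)

/-- The union of all pieces. -/
def carrier : Set (ℝ × ℝ) := {z | ∃ i, z.1 ∈ S.dom i ∧ height (ℓ i) z = 0}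

/-- A segment system is full if every endpoint of a piece lies on another piece, so that the
pieces cut the plane into convex cells. -/
def IsFull : Prop := ∀ i z, z.1 ∈ closure (S.dom i) → height (ℓ i) z = 0 → z ∈ S.carrier

variable {S}

lemma eq_of_mem_dom {i j : ι} {z : ℝ × ℝ} (hi : z.1 ∈ S.dom i) (hj : z.1 ∈ S.dom j)
    (hzi : height (ℓ i) z = 0) (hzj : height (ℓ j) z = 0) : i = j := by
  rw [height_eq_zero_iff] at hzi hzj
  by_contra hij
  exact S.apply_ne i j z.1 hij hi hj (hzi.symm.trans hzj)

lemma IsFull.isClosed_carrier [Finite ι] (hS : S.IsFull) : IsClosed S.carrier := by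
  have hcarrier : S.carrier = ⋃ i, {z | z.1 ∈ closure (S.dom i) ∧ height (ℓ i) z = 0} := by
    ext z
    simp only [mem_iUnion]
    exact ⟨fun ⟨i, hi, h0⟩ => ⟨i, subset_closure hi, h0⟩, fun ⟨i, hi, h0⟩ => hS i z hi h0⟩
  rw [hcarrier]
  exact isClosed_iUnion_of_finite fun i => (isClosed_closure.preimage continuous_fst).inter
    (isClosed_eq (continuous_height _) continuous_const)

lemma dense_compl_carrier [Finite ι] (S : SegmentSystem ℓ) : Dense S.carrierᶜ := by
  intro z
  have hfin : {y : ℝ | (z.1, y) ∈ S.carrier}.Finite := by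
    refine (finite_range fun i => ℓ i z.1).subset ?_
    rintro y ⟨i, -, h0⟩
    exact ⟨i, ((height_eq_zero_iff _).1 h0).symm⟩
  have hcont : Continuous fun y : ℝ => (z.1, y) := by fun_prop
  exact map_mem_closure hcont (hfin.countable.dense_compl ℝ z.2) fun y hy => hy

end Basic

section Extension

/-- The system whose `i`-th piece is prolonged to the open set `U`. -/
def prolong [DecidableEq ι] (S : SegmentSystem ℓ) (i : ι) (U : Set ℝ) (hU : IsOpen U)
    (hUc : U.OrdConnected) (hiU : S.dom i ⊆ U)
    (hne : ∀ j x, j ≠ i → x ∈ U → x ∈ S.dom j → ℓ i x ≠ ℓ j x) : SegmentSystem ℓ where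
  dom := Function.update S.dom i U
  isOpen_dom := (Function.forall_update_iff _ fun _ s => IsOpen s).2
    ⟨hU, fun k _ => S.isOpen_dom k⟩
  ordConnected_dom := (Function.forall_update_iff _ fun _ (s : Set ℝ) => s.OrdConnected).2
    ⟨hUc, fun k _ => S.ordConnected_dom k⟩
  nonempty_dom := (Function.forall_update_iff _ fun _ (s : Set ℝ) => s.Nonempty).2
    ⟨(S.nonempty_dom i).mono hiU, fun k _ => S.nonempty_dom k⟩
  apply_ne j k x hjk hj hk := by
    rcases eq_or_ne j i with rfl | hji
    · rw [Function.update_self] at hj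
      rw [Function.update_of_ne hjk.symm] at hk
      exact hne k x hjk.symm hj hk
    rw [Function.update_of_ne hji] at hj
    rcases eq_or_ne k i with rfl | hki
    · rw [Function.update_self] at hk
      exact (hne j x hji hk hj).symm
    · rw [Function.update_of_ne hki] at hk
      exact S.apply_ne j k x hjk hj hk

lemma exists_le_isMax (S : SegmentSystem ℓ) : ∃ T, S ≤ T ∧ IsMax T := by
  refine zorn_le_nonempty_Ici₀ S (fun c _ hchain T₀ hT₀ => ?_) S le_rfl
  have hsub : ∀ T ∈ c, ∀ i, T.dom i ⊆ ⋃ R ∈ c, R.dom i := fun T hT i =>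
    subset_biUnion_of_mem (u := fun R : SegmentSystem ℓ => R.dom i) hT
  -- any two points of the unions already lie in the domains of one member of the chain
  have hcommon : ∀ {i j x y}, x ∈ ⋃ R ∈ c, R.dom i → y ∈ ⋃ R ∈ c, R.dom j →
      ∃ R ∈ c, x ∈ R.dom i ∧ y ∈ R.dom j := by
    intro i j x y hx hy
    simp only [mem_iUnion, exists_prop] at hx hy
    obtain ⟨R, hR, hx⟩ := hx
    obtain ⟨R', hR', hy⟩ := hy
    rcases hchain.total hR hR' with h | h
    · exact ⟨R', hR', h i hx, hy⟩
    · exact ⟨R, hR, hx, h j hy⟩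
  refine ⟨⟨fun i => ⋃ R ∈ c, R.dom i, fun i => isOpen_biUnion fun R _ => R.isOpen_dom i,
    fun i => ⟨fun x hx y hy => ?_⟩, fun i => (T₀.nonempty_dom i).mono (hsub T₀ hT₀ i),
    fun i j x hij hx hy => ?_⟩, hsub⟩
  · obtain ⟨R, hR, hx, hy⟩ := hcommon hx hy
    exact ((R.ordConnected_dom i).out hx hy).trans (hsub R hR i)
  · obtain ⟨R, -, hx, hy⟩ := hcommon hx hy
    exact R.apply_ne i j x hij hx hy

variable {S : SegmentSystem ℓ}

lemma eventually_apply_ne [Finite ι] {i : ι} {z : ℝ × ℝ} (hz : height (ℓ i) z = 0)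
    (hzX : z ∉ S.carrier) : ∀ᶠ x in 𝓝 z.1, ∀ j, j ≠ i → x ∈ S.dom j → ℓ i x ≠ ℓ j x := by
  rw [eventually_all]
  intro j
  by_cases hij : ℓ i z.1 = ℓ j z.1
  · -- the lines meet only above `z.1`, which is not in the domain of piece `j`
    refine Eventually.of_forall fun x hji hx hx' => hji (ℓ.injective ?_)
    refine (eq_of_apply_eq_of_ne hx' hij ?_).symm
    rintro rfl
    exact hzX ⟨j, hx, by rw [height_eq_zero_iff] at hz ⊢; rw [hz, hij]⟩
  · have hcont : Continuous fun x => ℓ i x - ℓ j x :=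
      ((ℓ i).continuous_of_finiteDimensional).sub (ℓ j).continuous_of_finiteDimensional
    filter_upwards [hcont.continuousAt.eventually_ne (sub_ne_zero.2 hij)] with x hx _ _
    exact sub_ne_zero.1 hx

lemma isFull_of_isMax [Finite ι] (hS : IsMax S) : S.IsFull := by
  classical
  intro i z hzi hz
  by_contra hzX
  obtain ⟨ε, hε, hball⟩ := Metric.eventually_nhds_iff_ball.1 (eventually_apply_ne hz hzX)
  have hconn : (S.dom i ∪ Metric.ball z.1 ε).OrdConnected := by
    obtain ⟨x, hx, hxi⟩ := mem_closure_iff.1 hzi _ Metric.isOpen_ball (Metric.mem_ball_self hε)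
    exact isPreconnected_iff_ordConnected.1 (IsPreconnected.union x hxi hx
      (isPreconnected_iff_ordConnected.2 (S.ordConnected_dom i)) (convex_ball _ ε).isPreconnected)
  let T : SegmentSystem ℓ := S.prolong i (S.dom i ∪ Metric.ball z.1 ε)
    ((S.isOpen_dom i).union Metric.isOpen_ball) hconn subset_union_left (by
      rintro j x hji (hx | hx) hxj
      · exact S.apply_ne i j x hji.symm hx hxj
      · exact hball x hx j hji hxj)
  have hST : S.dom ≤ T.dom := le_update_iff.2 ⟨subset_union_left, fun k _ => le_rfl⟩
  have hle : T.dom i ⊆ S.dom i := hS hST i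
  have hTi : T.dom i = S.dom i ∪ Metric.ball z.1 ε := by
    simp [T, prolong]
  rw [hTi] at hle
  exact hzX ⟨i, hle (Or.inr (Metric.mem_ball_self hε)), hz⟩

theorem exists_le_isFull [Finite ι] (S : SegmentSystem ℓ) : ∃ T, S ≤ T ∧ T.IsFull :=
  let ⟨T, hST, hT⟩ := S.exists_le_isMax
  ⟨T, hST, isFull_of_isMax hT⟩

end Extension

section Transitivity

variable {S : SegmentSystem ℓ} {i : ι} {p q r w z : ℝ × ℝ}

-- A transversal crossing of a piece persists under small perturbations of the second endpoint.
lemma eventually_not_visible_of_height_ne (hp : p ∉ S.carrier) (hw : w ∉ S.carrier)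
    (hz : z ∈ segment ℝ p w) (hzi : z.1 ∈ S.dom i) (hz0 : height (ℓ i) z = 0)
    (hne : height (ℓ i) p ≠ height (ℓ i) w) : ∀ᶠ w' in 𝓝 w, ¬ Visible S.carrier p w' := by
  rw [segment_eq_image_lineMap] at hz
  obtain ⟨s, hs, rfl⟩ := hz
  have hzX : AffineMap.lineMap p w s ∈ S.carrier := ⟨i, hzi, hz0⟩
  have hs0 : s ≠ 0 := by rintro rfl; exact hp (by simpa using hzX)
  have hs1 : s ≠ 1 := by rintro rfl; exact hw (by simpa using hzX)
  let σ : ℝ × ℝ → ℝ := fun w' => height (ℓ i) p / (height (ℓ i) p - height (ℓ i) w')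
  have hσw : σ w = s := by
    rw [AffineMap.apply_lineMap, AffineMap.lineMap_apply_module', smul_eq_mul] at hz0
    rw [div_eq_iff (sub_ne_zero.2 hne)]
    linarith
  have hσ : ContinuousAt σ w := continuousAt_const.div
    (continuousAt_const.sub (continuous_height _).continuousAt) (sub_ne_zero.2 hne)
  have hσ_mem : ∀ᶠ w' in 𝓝 w, σ w' ∈ Ioo (0 : ℝ) 1 := hσ.eventually_mem
    (isOpen_Ioo.mem_nhds (hσw ▸ ⟨hs.1.lt_of_ne' hs0, hs.2.lt_of_ne hs1⟩))
  have hdom : ∀ᶠ w' in 𝓝 w, (AffineMap.lineMap p w' (σ w') : ℝ × ℝ).1 ∈ S.dom i := by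
    have hcont : ContinuousAt (fun w' => (AffineMap.lineMap p w' (σ w') : ℝ × ℝ).1) w := by
      simp only [AffineMap.lineMap_apply_module']
      fun_prop
    exact hcont.eventually_mem ((S.isOpen_dom i).mem_nhds (by rwa [hσw]))
  filter_upwards [hσ_mem, hdom, (continuous_height (ℓ i)).continuousAt.eventually_ne hne.symm]
    with w' hσ' hdom' hne' hvis
  refine hvis.lineMap_notMem (Ioo_subset_Icc_self hσ') ⟨i, hdom', ?_⟩
  have := sub_ne_zero.2 hne'.symm
  rw [AffineMap.apply_lineMap, AffineMap.lineMap_apply_module', smul_eq_mul]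
  simp only [σ]
  field_simp
  ring

lemma height_eq_zero_of_mem_segment (l : ℝ →ᵃ[ℝ] ℝ) (hp : height l p = 0) (hw : height l w = 0)
    (hz : z ∈ segment ℝ p w) : height l z = 0 :=
  ((convex_singleton 0).affine_preimage (height l)).segment_subset hp hw hz

lemma IsFull.exists_ne_of_mem_segment (hS : S.IsFull) (hp : p ∉ S.carrier)
    (hp0 : height (ℓ i) p = 0) (hw0 : height (ℓ i) w = 0) (hz : z ∈ segment ℝ p w)
    (hzi : z.1 ∈ S.dom i) :
    ∃ j ≠ i, ∃ z' ∈ segment ℝ p w, z'.1 ∈ S.dom j ∧ height (ℓ j) z' = 0 := by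
  -- the segment leaves piece `i` at an endpoint of the piece
  obtain ⟨z', ⟨hz'i, hz'⟩, hz'n⟩ := not_subset.1 fun hsub => hp ⟨i,
    (convex_segment p w).isPreconnected.subset_of_closure_inter_subset
      ((S.isOpen_dom i).preimage continuous_fst) ⟨z, hz, hzi⟩ hsub (left_mem_segment ℝ p w), hp0⟩
  have hcl : z'.1 ∈ closure (S.dom i) := map_mem_closure continuous_fst hz'i fun _ h => h
  obtain ⟨j, hj, hj0⟩ := hS i z' hcl (height_eq_zero_of_mem_segment _ hp0 hw0 hz')
  exact ⟨j, fun h => hz'n (h ▸ hj), z', hz', hj, hj0⟩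

/- Sweep the segment `p w` from `w = q` to `w = r` until it first meets the carrier. Every piece met
by this extremal segment is parallel to it, but in a full system a piece contained in its line ends
on another piece, whose line is different. -/
theorem IsFull.visible_trans [Finite ι] (hS : S.IsFull) (hpq : Visible S.carrier p q)
    (hqr : Visible S.carrier q r) : Visible S.carrier p r := by
  by_contra hpr
  obtain ⟨t, ht, hblocked, hfirst⟩ := hpq.exists_first_blocked hS.isClosed_carrier hpr
  set w := AffineMap.lineMap q r t
  have hp : p ∉ S.carrier := hpq.left_notMem
  have hw : w ∉ S.carrier := hqr.lineMap_notMem (Ioc_subset_Icc_self ht)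
  have hvisible : ∃ᶠ w' in 𝓝 w, Visible S.carrier p w' := by
    have hcont : Tendsto (fun t' : ℝ => (AffineMap.lineMap q r t' : ℝ × ℝ)) (𝓝[<] t) (𝓝 w) :=
      (AffineMap.lineMap_continuous.tendsto t).mono_left nhdsWithin_le_nhds
    exact hcont.frequently (Eventually.frequently
      (by filter_upwards [Ioo_mem_nhdsLT ht.1] with t' ht' using hfirst t' ⟨ht'.1.le, ht'.2⟩))
  have hparallel : ∀ j, ∀ z ∈ segment ℝ p w, z.1 ∈ S.dom j → height (ℓ j) z = 0 →
      height (ℓ j) p = 0 ∧ height (ℓ j) w = 0 := by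
    intro j z hz hj hz0
    have heq : height (ℓ j) p = height (ℓ j) w := by
      by_contra hne
      exact hvisible (eventually_not_visible_of_height_ne hp hw hz hj hz0 hne)
    have hconst : height (ℓ j) z = height (ℓ j) w :=
      ((convex_singleton _).affine_preimage (height (ℓ j))).segment_subset heq rfl hz
    exact ⟨heq.trans (hconst.symm.trans hz0), hconst.symm.trans hz0⟩
  obtain ⟨z, hz, i, hi, hz0⟩ := not_disjoint_iff.1 hblocked
  obtain ⟨hpi, hwi⟩ := hparallel i z hz hi hz0
  obtain ⟨j, hji, z', hz', hj, hz'0⟩ := hS.exists_ne_of_mem_segment hp hpi hwi hz hi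
  obtain ⟨hpj, hwj⟩ := hparallel j z' hz' hj hz'0
  rw [height_eq_zero_iff] at hpi hwi hpj hwj
  refine hji (ℓ.injective (eq_of_apply_eq_of_ne (hpj.symm.trans hpi) (hwj.symm.trans hwi) ?_))
  intro hpw
  have : p = w := Prod.ext hpw (by rw [hpi, hwi, hpw])
  rw [← this, segment_same, mem_singleton_iff] at hz
  exact hp (hz ▸ ⟨i, hi, hz0⟩)

end Transitivity

section Sides

variable (S : SegmentSystem ℓ) (i : ι)

/-- The abscissa `x` lies on piece `i` away from the closures of all other pieces. -/
def IsFreeAt (x : ℝ) : Prop := ∀ k, k ≠ i → x ∈ closure (S.dom k) → ℓ i x ≠ ℓ k x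

lemma finite_not_isFreeAt [Finite ι] : {x | ¬ S.IsFreeAt i x}.Finite := by
  have hsub : {x | ¬ S.IsFreeAt i x} ⊆ ⋃ k, {x | k ≠ i ∧ ℓ i x = ℓ k x} := by
    intro x hx
    simp only [IsFreeAt, mem_ofPred_eq, not_forall, not_not] at hx
    obtain ⟨k, hk, -, h⟩ := hx
    exact mem_iUnion.2 ⟨k, hk, h⟩
  refine (finite_iUnion fun k => Set.Subsingleton.finite ?_).subset hsub
  rintro x ⟨hk, hx⟩ y ⟨-, hy⟩
  by_contra hxy
  exact hk (ℓ.injective (eq_of_apply_eq_of_ne hx hy hxy)).symm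

variable {i} in
lemma exists_mem_dom_lt {x : ℝ} (hx : x ∈ S.dom i) : ∃ a ∈ S.dom i, a < x := by
  obtain ⟨l, hl, hsub⟩ := exists_Ioc_subset_of_mem_nhds ((S.isOpen_dom i).mem_nhds hx) (exists_lt x)
  obtain ⟨a, hla, hax⟩ := exists_between hl
  exact ⟨a, hsub ⟨hla, hax.le⟩, hax⟩

lemma exists_initial_isFreeAt [Finite ι] :
    ∃ c ∈ S.dom i, ∀ x ∈ S.dom i, x ≤ c → S.IsFreeAt i x := by
  have hB : ({x | ¬ S.IsFreeAt i x} ∩ S.dom i).Finite := (S.finite_not_isFreeAt i).inter_of_left _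
  obtain hempty | hne := ({x | ¬ S.IsFreeAt i x} ∩ S.dom i).eq_empty_or_nonempty
  · obtain ⟨c, hc⟩ := S.nonempty_dom i
    refine ⟨c, hc, fun x hx _ => ?_⟩
    by_contra hfree
    exact (hempty.subset ⟨hfree, hx⟩ : x ∈ (∅ : Set ℝ))
  · obtain ⟨x₀, ⟨-, hx₀⟩, hmin⟩ := exists_min_image _ id hB hne
    obtain ⟨c, hc, hlt⟩ := S.exists_mem_dom_lt hx₀
    refine ⟨c, hc, fun x hx hxc => ?_⟩
    by_contra hfree
    exact absurd (hmin x ⟨hfree, hx⟩) (not_le.2 (hxc.trans_lt hlt))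

lemma isClosed_iUnion_other [Finite ι] :
    IsClosed (⋃ k, {z : ℝ × ℝ | k ≠ i ∧ z.1 ∈ closure (S.dom k) ∧ height (ℓ k) z = 0}) := by
  refine isClosed_iUnion_of_finite fun k => ?_
  by_cases hk : k = i
  · simp [hk]
  · simp only [ne_eq, hk, not_false_eq_true, true_and]
    exact (isClosed_closure.preimage continuous_fst).inter
      (isClosed_eq (continuous_height _) continuous_const)

variable {S i}

lemma exists_strip [Finite ι] {a c : ℝ} (hfree : ∀ x ∈ Icc a c, S.IsFreeAt i x) :
    ∃ δ > 0, ∀ w : ℝ × ℝ, w.1 ∈ Icc a c → |height (ℓ i) w| < δ → w ∈ S.carrier →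
      height (ℓ i) w = 0 := by
  have hK : IsCompact ((fun x => (x, ℓ i x)) '' Icc a c) := isCompact_Icc.image
    (continuous_id.prodMk (ℓ i).continuous_of_finiteDimensional)
  obtain ⟨δ, hδ, hsub⟩ := hK.exists_thickening_subset_open
    (S.isClosed_iUnion_other i).isOpen_compl (by
      rintro _ ⟨x, hx, rfl⟩ hmem
      obtain ⟨k, hk, hxk, h0⟩ := mem_iUnion.1 hmem
      exact hfree x hx k hk hxk ((height_eq_zero_iff _).1 h0))
  refine ⟨δ, hδ, fun w hw hwδ ⟨k, hk, hk0⟩ => ?_⟩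
  rcases eq_or_ne k i with rfl | hki
  · exact hk0
  have hmem : w ∈ ⋃ k, {z : ℝ × ℝ | k ≠ i ∧ z.1 ∈ closure (S.dom k) ∧ height (ℓ k) z = 0} :=
    mem_iUnion.2 ⟨k, hki, subset_closure hk, hk0⟩
  refine absurd hmem (hsub ?_)
  refine Metric.mem_thickening_iff.2 ⟨_, mem_image_of_mem _ hw, ?_⟩
  rw [Prod.dist_eq, max_lt_iff]
  exact ⟨by simpa using hδ, by simpa [Real.dist_eq, height_apply] using hwδ⟩

lemma visible_of_mem_strip {a c δ κ : ℝ} (hstrip : ∀ w : ℝ × ℝ, w.1 ∈ Icc a c →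
      |height (ℓ i) w| < δ → w ∈ S.carrier → height (ℓ i) w = 0) {p q : ℝ × ℝ}
    (hp : p.1 ∈ Icc a c) (hpδ : |height (ℓ i) p| < δ) (hpκ : p ∈ halfPlane (ℓ i) κ)
    (hq : q.1 ∈ Icc a c) (hqδ : |height (ℓ i) q| < δ) (hqκ : q ∈ halfPlane (ℓ i) κ) :
    Visible S.carrier p q := by
  have hconvex : Convex ℝ ({w : ℝ × ℝ | w.1 ∈ Icc a c} ∩ {w | |height (ℓ i) w| < δ} ∩
      halfPlane (ℓ i) κ) := by
    refine (((convex_Icc a c).affine_preimage AffineMap.fst).inter ?_).inter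
      (convex_halfPlane _ κ)
    convert (convex_Ioo (-δ) δ).affine_preimage (height (ℓ i)) using 1
    ext w
    simp [abs_lt]
  refine Visible.of_convex hconvex (disjoint_left.2 ?_) ⟨⟨hp, hpδ⟩, hpκ⟩ ⟨⟨hq, hqδ⟩, hqκ⟩
  rintro w ⟨⟨hw, hwδ⟩, hwκ⟩ hwX
  simp [halfPlane, hstrip w hw hwδ hwX] at hwκ

-- `κ = ±1` selects the upper or the lower side of the piece.
lemma IsFull.exists_side [Finite ι] (hS : S.IsFull) {c κ : ℝ} (hκ : |κ| = 1) (hc : c ∈ S.dom i)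
    (hfree : ∀ x ∈ S.dom i, x ≤ c → S.IsFreeAt i x) :
    ∃ u ∉ S.carrier, ∀ z : ℝ × ℝ, z.1 ∈ S.dom i → height (ℓ i) z = 0 → z.1 < c →
      ∀ᶠ w in 𝓝 z, w ∈ halfPlane (ℓ i) κ → Visible S.carrier w u := by
  have hκ2 : κ * κ = 1 := by rw [← abs_mul_abs_self, hκ, one_mul]
  let v : ℝ → ℝ × ℝ := fun μ => (c, ℓ i c + κ * μ)
  have hv : ∀ μ, height (ℓ i) (v μ) = κ * μ := fun μ => height_mk_add ..
  have hvκ : ∀ μ, 0 < μ → v μ ∈ halfPlane (ℓ i) κ := fun μ hμ => by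
    rwa [halfPlane, mem_ofPred_eq, hv, ← mul_assoc, hκ2, one_mul]
  have hvabs : ∀ μ, 0 < μ → |height (ℓ i) (v μ)| = μ := fun μ hμ => by
    rw [hv, abs_mul, hκ, one_mul, abs_of_pos hμ]
  obtain ⟨δ₀, hδ₀, hstrip₀⟩ := exists_strip (S := S) (i := i) (a := c) (c := c) fun x hx => by
    obtain rfl : x = c := le_antisymm hx.2 hx.1
    exact hfree x hc le_rfl
  have hcc : c ∈ Icc c c := ⟨le_rfl, le_rfl⟩
  have hδ₀' : |height (ℓ i) (v (δ₀ / 2))| < δ₀ := by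
    rw [hvabs _ (half_pos hδ₀)]; exact half_lt_self hδ₀
  refine ⟨v (δ₀ / 2), fun hX => ?_, fun z hz hz0 hzc => ?_⟩
  · have := hvκ _ (half_pos hδ₀)
    simp [halfPlane, hstrip₀ _ hcc hδ₀' hX] at this
  obtain ⟨a, ha, haz⟩ := S.exists_mem_dom_lt hz
  obtain ⟨δ, hδ, hstrip⟩ := exists_strip (S := S) (i := i) (a := a) (c := c) fun x hx =>
    hfree x ((S.ordConnected_dom i).out ha hc hx) hx.2
  obtain ⟨μ, hμ, hμδ⟩ := exists_between (lt_min hδ hδ₀)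
  rw [lt_min_iff] at hμδ
  have hheight : ∀ᶠ w in 𝓝 z, |height (ℓ i) w| < δ :=
    (continuous_height (ℓ i)).abs.continuousAt.eventually_lt_const (by simpa [hz0] using hδ)
  filter_upwards [hheight, continuous_fst.continuousAt.eventually_mem (Ioo_mem_nhds haz hzc)]
    with w hw hwx hwκ
  have hwv : Visible S.carrier w (v μ) := visible_of_mem_strip hstrip (Ioo_subset_Icc_self hwx) hw
    hwκ ⟨(haz.trans hzc).le, le_rfl⟩ ((hvabs μ hμ).trans_lt hμδ.1) (hvκ μ hμ)
  exact hS.visible_trans hwv (visible_of_mem_strip hstrip₀ hcc ((hvabs μ hμ).trans_lt hμδ.2)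
    (hvκ μ hμ) hcc hδ₀' (hvκ _ (half_pos hδ₀)))

lemma IsFull.exists_sides [Finite ι] (hS : S.IsFull) (i : ι) :
    ∃ c ∈ S.dom i, ∃ u v : ℝ × ℝ, u ∉ S.carrier ∧ v ∉ S.carrier ∧
      ∀ z : ℝ × ℝ, z.1 ∈ S.dom i → height (ℓ i) z = 0 → z.1 < c →
        ∀ᶠ w in 𝓝 z, w ∉ S.carrier → Visible S.carrier w u ∨ Visible S.carrier w v := by
  obtain ⟨c, hc, hfree⟩ := S.exists_initial_isFreeAt i
  obtain ⟨u, hu, hupper⟩ := hS.exists_side (κ := 1) (by simp) hc hfree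
  obtain ⟨v, hv, hlower⟩ := hS.exists_side (κ := -1) (by simp) hc hfree
  refine ⟨c, hc, u, v, hu, hv, fun z hz hz0 hzc => ?_⟩
  filter_upwards [hupper z hz hz0 hzc, hlower z hz hz0 hzc,
    continuous_fst.continuousAt.eventually_mem ((S.isOpen_dom i).mem_nhds hz)]
    with w hwu hwv hwi hwX
  rcases lt_trichotomy (height (ℓ i) w) 0 with hneg | h0 | hpos
  · exact Or.inr (hwv (by simpa [halfPlane] using hneg))
  · exact absurd ⟨i, hwi, h0⟩ hwX
  · exact Or.inl (hwu (by simpa [halfPlane] using hpos))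

end Sides

section Counting

variable {S : SegmentSystem ℓ}

section Leftmost

variable {F : Set (ℝ × ℝ)} {c : ι → ℝ}

lemma exists_leftmost [Finite ι] (hF : IsClosed F) (hne : F.Nonempty) (hFX : F ⊆ S.carrier)
    (hleft : ∀ i, ∀ z ∈ F, z.1 ∈ S.dom i → height (ℓ i) z = 0 → c i ≤ z.1) :
    ∃ z ∈ F, ∀ w ∈ F, z.1 ≤ w.1 := by
  obtain ⟨z₀, hz₀⟩ := hne
  have hcompact : IsCompact (⋃ i, (fun x => (x, ℓ i x)) '' Icc (c i) z₀.1) :=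
    isCompact_iUnion fun i => isCompact_Icc.image
      (continuous_id.prodMk (ℓ i).continuous_of_finiteDimensional)
  have hsub : F ∩ {w | w.1 ≤ z₀.1} ⊆ ⋃ i, (fun x => (x, ℓ i x)) '' Icc (c i) z₀.1 := by
    rintro w ⟨hwF, hw⟩
    obtain ⟨i, hi, h0⟩ := hFX hwF
    exact mem_iUnion.2 ⟨i, w.1, ⟨hleft i w hwF hi h0, hw⟩,
      Prod.ext rfl ((height_eq_zero_iff _).1 h0).symm⟩
  obtain ⟨z, hz, hmin⟩ := (hcompact.of_isClosed_subset (hF.inter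
    (isClosed_le continuous_fst continuous_const)) hsub).exists_isMinOn ⟨z₀, hz₀, le_refl z₀.1⟩
    continuous_fst.continuousOn
  refine ⟨z, hz.1, fun w hw => ?_⟩
  rcases le_total w.1 z₀.1 with h | h
  · exact hmin ⟨hw, h⟩
  · exact hz.2.trans h

lemma eventually_height_eq_zero_of_leftmost [Finite ι] (hFX : F ⊆ S.carrier)
    (hc : ∀ i, c i ∈ S.dom i)
    (hleft : ∀ i, ∀ z ∈ F, z.1 ∈ S.dom i → height (ℓ i) z = 0 → c i ≤ z.1) {j : ι} {z : ℝ × ℝ}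
    (hmin : ∀ w ∈ F, z.1 ≤ w.1) (hj : z.1 ∈ S.dom j) (hz0 : height (ℓ j) z = 0) :
    ∀ᶠ w in 𝓝 z, w ∈ F → height (ℓ j) w = 0 := by
  have hother : ∀ k, ∀ᶠ w in 𝓝 z, k ≠ j → w ∈ F → w.1 ∈ S.dom k → height (ℓ k) w ≠ 0 := by
    intro k
    by_cases hzk : height (ℓ k) z = 0
    · by_cases hlt : z.1 < c k
      · filter_upwards [continuous_fst.continuousAt.eventually_lt_const hlt] with w hw _ hwF hk h0
        exact (hleft k w hwF hk h0).not_gt hw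
      · refine Eventually.of_forall fun w hkj hwF hk _ => hkj ?_
        exact eq_of_mem_dom ((S.ordConnected_dom k).out (hc k) hk ⟨not_lt.1 hlt, hmin w hwF⟩) hj
          hzk hz0
    · filter_upwards [(continuous_height (ℓ k)).continuousAt.eventually_ne hzk] with w hw _ _ _
      exact hw
  filter_upwards [eventually_all.2 hother] with w hw hwF
  obtain ⟨k, hk, h0⟩ := hFX hwF
  rcases eq_or_ne k j with rfl | hkj
  · exact h0
  · exact absurd h0 (hw k hkj hwF hk)

end Leftmost

lemma isPreconnected_slit {C : Set (ℝ × ℝ)} (hC : Convex ℝ C) (l : ℝ →ᵃ[ℝ] ℝ) {x b : ℝ}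
    (hx : (x, l x) ∈ C) (hxb : x < b) :
    IsPreconnected {w ∈ C | height l w = 0 → w.1 < b} := by
  have hmem : (x, l x) ∈ {w ∈ C | height l w = 0 → w.1 < b} := ⟨hx, fun _ => hxb⟩
  have hstar : StarConvex ℝ (x, l x) {w ∈ C | height l w = 0 → w.1 < b} := by
    refine (starConvex_iff_forall_pos hmem).2 ?_
    rintro w ⟨hwC, hw⟩ s t hs ht hst
    refine ⟨hC hx hwC hs.le ht.le hst, fun h0 => ?_⟩
    have hx0 : height l (x, l x) = 0 := (height_eq_zero_iff l).2 rfl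
    rw [Convex.combo_affine_apply hst, hx0, smul_zero, zero_add, smul_eq_mul] at h0
    exact convex_Iio b hxb (hw ((mul_eq_zero.1 h0).resolve_left ht.ne')) hs.le ht.le hst
  exact (hstar.isPathConnected hmem).isConnected.isPreconnected

lemma isPreconnected_ball_slit {l : ℝ →ᵃ[ℝ] ℝ} {z : ℝ × ℝ} {ε : ℝ} (hε : 0 < ε)
    (hz : height l z = 0) : IsPreconnected {w ∈ Metric.ball z ε | height l w = 0 → w.1 < z.1} := by
  have hgraph : Tendsto (fun x => (x, l x)) (𝓝[<] z.1) (𝓝 z) := by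
    have hcont : Continuous fun x => (x, l x) :=
      continuous_id.prodMk l.continuous_of_finiteDimensional
    convert (hcont.tendsto z.1).mono_left nhdsWithin_le_nhds using 2
    exact Prod.ext rfl ((height_eq_zero_iff _).1 hz)
  obtain ⟨x, hx, hxz⟩ := ((hgraph.eventually_mem (Metric.ball_mem_nhds z hε)).and
    self_mem_nhdsWithin).exists
  exact isPreconnected_slit (convex_ball z ε) l hx hxz

section Colouring

variable {f : ℝ × ℝ → Prop}

variable (S f) in
/-- The interface of a two-colouring of the complement of the carrier: the points at which both
colours accumulate. -/
def interface : Set (ℝ × ℝ) :=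
  closure {z | z ∉ S.carrier ∧ f z} ∩ closure {z | z ∉ S.carrier ∧ ¬ f z}

lemma isClosed_interface : IsClosed (S.interface f) :=
  isClosed_closure.inter isClosed_closure

lemma inter_interface_nonempty [Finite ι] {Y : Set (ℝ × ℝ)} (hY : IsPreconnected Y) {a b : ℝ × ℝ}
    (ha : a ∈ Y) (haX : a ∉ S.carrier) (hfa : f a) (hb : b ∈ Y) (hbX : b ∉ S.carrier)
    (hfb : ¬ f b) : (Y ∩ S.interface f).Nonempty := by
  have hcover : closure {z | z ∉ S.carrier ∧ f z} ∪ closure {z | z ∉ S.carrier ∧ ¬ f z} = univ := by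
    rw [← closure_union, ← S.dense_compl_carrier.closure_eq]
    congr 1
    ext z
    simp only [mem_union, mem_ofPred_eq, mem_compl_iff]
    tauto
  exact isPreconnected_closed_iff.1 hY _ _ isClosed_closure isClosed_closure
    (hcover ▸ subset_univ Y) ⟨a, ha, subset_closure ⟨haX, hfa⟩⟩ ⟨b, hb, subset_closure ⟨hbX, hfb⟩⟩

lemma IsFull.eventually_visible [Finite ι] (hS : S.IsFull) {z : ℝ × ℝ} (hz : z ∉ S.carrier) :
    ∀ᶠ w in 𝓝 z, Visible S.carrier z w := by
  obtain ⟨ε, hε, hball⟩ := Metric.isOpen_iff.1 hS.isClosed_carrier.isOpen_compl z hz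
  filter_upwards [Metric.ball_mem_nhds z hε] with w hw
  exact Visible.of_convex (convex_ball z ε) (disjoint_left.2 fun a ha => hball ha)
    (Metric.mem_ball_self hε) hw

lemma IsFull.interface_subset_carrier [Finite ι] (hS : S.IsFull)
    (hf : ∀ p q, Visible S.carrier p q → f p → f q) : S.interface f ⊆ S.carrier := by
  rintro z ⟨hz, hz'⟩
  by_contra hzX
  have hev := hS.eventually_visible hzX
  obtain ⟨a, ⟨-, hfa⟩, hza⟩ := ((mem_closure_iff_frequently.1 hz).and_eventually hev).exists
  obtain ⟨b, ⟨-, hfb⟩, hzb⟩ := ((mem_closure_iff_frequently.1 hz').and_eventually hev).exists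
  exact hfb (hf z b hzb (hf a z hza.symm hfa))

lemma le_of_mem_interface {i : ι} {c : ℝ} {u v : ℝ × ℝ}
    (huv : ∀ z : ℝ × ℝ, z.1 ∈ S.dom i → height (ℓ i) z = 0 → z.1 < c →
      ∀ᶠ w in 𝓝 z, w ∉ S.carrier → Visible S.carrier w u ∨ Visible S.carrier w v)
    (hf : ∀ p q, Visible S.carrier p q → f p → f q) (hfuv : f u ↔ f v) :
    ∀ z ∈ S.interface f, z.1 ∈ S.dom i → height (ℓ i) z = 0 → c ≤ z.1 := by
  rintro z ⟨hz, hz'⟩ hzi hz0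
  by_contra! hlt
  have hev := huv z hzi hz0 hlt
  obtain ⟨a, ⟨haX, hfa⟩, ha⟩ := ((mem_closure_iff_frequently.1 hz).and_eventually hev).exists
  obtain ⟨b, ⟨hbX, hfb⟩, hb⟩ := ((mem_closure_iff_frequently.1 hz').and_eventually hev).exists
  have hfu : f u := (ha haX).elim (fun h => hf a u h hfa) fun h => hfuv.2 (hf a v h hfa)
  exact hfb ((hb hbX).elim (fun h => hf u b h.symm hfu) fun h => hf v b h.symm (hfuv.1 hfu))

/- The interface of a nonconstant colouring would have a leftmost point. Near it the interface runs
along a single piece and to the right only, so it fails to separate the two colours there. -/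
theorem IsFull.colouring_const [Finite ι] (hS : S.IsFull) {c : ι → ℝ} {u v : ι → ℝ × ℝ}
    (hc : ∀ i, c i ∈ S.dom i)
    (huv : ∀ i, ∀ z : ℝ × ℝ, z.1 ∈ S.dom i → height (ℓ i) z = 0 → z.1 < c i →
      ∀ᶠ w in 𝓝 z, w ∉ S.carrier → Visible S.carrier w (u i) ∨ Visible S.carrier w (v i))
    (hf : ∀ p q, Visible S.carrier p q → f p → f q) (hfuv : ∀ i, f (u i) ↔ f (v i))
    {p q : ℝ × ℝ} (hp : p ∉ S.carrier) (hq : q ∉ S.carrier) (hfp : f p) : f q := by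
  by_contra hfq
  have hFX := hS.interface_subset_carrier hf
  have hleft := fun i => le_of_mem_interface (huv i) hf (hfuv i)
  have hne : (S.interface f).Nonempty := by
    simpa using inter_interface_nonempty isPreconnected_univ (mem_univ p) hp hfp (mem_univ q) hq hfq
  obtain ⟨z, hz, hmin⟩ := exists_leftmost isClosed_interface hne hFX hleft
  obtain ⟨j, hj, hz0⟩ := hFX hz
  obtain ⟨ε, hε, hball⟩ := Metric.eventually_nhds_iff_ball.1
    ((eventually_height_eq_zero_of_leftmost hFX hc hleft hmin hj hz0).and
      (continuous_fst.continuousAt.eventually_mem ((S.isOpen_dom j).mem_nhds hj)))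
  let Y : Set (ℝ × ℝ) := {w ∈ Metric.ball z ε | height (ℓ j) w = 0 → w.1 < z.1}
  have hY : IsPreconnected Y := isPreconnected_ball_slit hε hz0
  have hmemY : ∀ w ∈ Metric.ball z ε, w ∉ S.carrier → w ∈ Y := fun w hw hwX =>
    ⟨hw, fun h0 => absurd ⟨j, (hball w hw).2, h0⟩ hwX⟩
  have hzε : ∀ᶠ w in 𝓝 z, w ∈ Metric.ball z ε := Metric.ball_mem_nhds z hε
  obtain ⟨a, ⟨haX, hfa⟩, ha⟩ := ((mem_closure_iff_frequently.1 hz.1).and_eventually hzε).exists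
  obtain ⟨b, ⟨hbX, hfb⟩, hb⟩ := ((mem_closure_iff_frequently.1 hz.2).and_eventually hzε).exists
  obtain ⟨w, ⟨hw, hwz⟩, hwF⟩ := inter_interface_nonempty hY (hmemY a ha haX) haX hfa
    (hmemY b hb hbX) hbX hfb
  exact (hmin w hwF).not_gt (hwz ((hball w hw).1 hwF))

end Colouring

end Counting

section Cells

variable {S : SegmentSystem ℓ}

/-- Visibility as an equivalence relation on the complement of the carrier; its classes are the
cells of the system. -/
def visibleSetoid [Finite ι] (hS : S.IsFull) : Setoid {z : ℝ × ℝ // z ∉ S.carrier} where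
  r p q := Visible S.carrier p.1 q.1
  iseqv := ⟨fun p => visible_self p.2, Visible.symm, hS.visible_trans⟩

theorem finite_and_card_quotient_le [Finite ι] (hS : S.IsFull) :
    Finite (Quotient (visibleSetoid hS)) ∧
      Nat.card (Quotient (visibleSetoid hS)) ≤ Nat.card ι + 1 := by
  choose c hc u v hu hv huv using hS.exists_sides
  refine finite_and_card_le_of_forall_const (fun i => Quotient.mk (visibleSetoid hS) ⟨u i, hu i⟩)
    (fun i => Quotient.mk (visibleSetoid hS) ⟨v i, hv i⟩) fun f hf k l hk => ?_
  induction k using Quotient.inductionOn with | h p => ?_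
  induction l using Quotient.inductionOn with | h q => ?_
  let g : ℝ × ℝ → Prop := fun z => ∃ h : z ∉ S.carrier, f (Quotient.mk (visibleSetoid hS) ⟨z, h⟩)
  have hg : ∀ z (h : z ∉ S.carrier), g z ↔ f (Quotient.mk (visibleSetoid hS) ⟨z, h⟩) :=
    fun z h => exists_prop_of_true h
  have hgvis : ∀ a b, Visible S.carrier a b → g a → g b := by
    rintro a b hab ⟨ha, hfa⟩
    have hclass : Quotient.mk (visibleSetoid hS) ⟨a, ha⟩ =
        Quotient.mk (visibleSetoid hS) ⟨b, hab.right_notMem⟩ := Quotient.sound hab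
    exact ⟨hab.right_notMem, hclass ▸ hfa⟩
  have hguv : ∀ i, g (u i) ↔ g (v i) := fun i => by
    rw [hg _ (hu i), hg _ (hv i)]
    exact hf i
  exact (hg _ q.2).1 (hS.colouring_const hc huv hgvis hguv p.2 q.2 ⟨p.2, hk⟩)

theorem IsFull.exists_isConvexPartition [Finite ι] (hS : S.IsFull) :
    ∃ (K : Type) (_ : Finite K) (C : K → Set (ℝ × ℝ)), Nat.card K ≤ Nat.card ι + 1 ∧
      IsConvexPartition S.carrierᶜ C := by
  obtain ⟨hfin, hcard⟩ := finite_and_card_quotient_le hS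
  refine ⟨_, hfin, fun k => {z | ∃ h : z ∉ S.carrier, Quotient.mk (visibleSetoid hS) ⟨z, h⟩ = k},
    hcard, fun k => ?_, fun k l hkl => ?_, by ext z; simp⟩
  · rw [convex_iff_segment_subset]
    rintro x ⟨hx, hxk⟩ y ⟨hy, hyk⟩ z hz
    have hxy : Visible S.carrier x y := Quotient.exact (hxk.trans hyk.symm)
    have hxz : Visible S.carrier x z :=
      hxy.mono_left ((convex_segment x y).segment_subset (left_mem_segment ℝ x y) hz)
    refine ⟨hxz.right_notMem, Eq.trans (Quotient.sound ?_) hxk⟩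
    exact hxz.symm
  · refine disjoint_left.2 ?_
    rintro z ⟨h, hk⟩ ⟨_, hl⟩
    exact hkl (hk.symm.trans hl)

section Incidence

variable {K : Type*} {C : K → Set (ℝ × ℝ)} {z : ℝ × ℝ}

lemma notMem_closure_both_sides (hC : IsConvexPartition S.carrierᶜ C) {D : Set (ℝ × ℝ)}
    (hD : Convex ℝ D) {i : ι} {κ : ℝ}
    (hfill : ∀ᶠ w in 𝓝 z, w ∈ D → height (ℓ i) w = 0 → w.1 ∈ S.dom i) {k : K}
    (hk : z ∈ closure (C k ∩ (D ∩ halfPlane (ℓ i) κ))) :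
    z ∉ closure (C k ∩ (D ∩ halfPlane (ℓ i) (-κ))) := by
  simp only [← inter_assoc] at hk ⊢
  refine notMem_closure_inter_halfPlane_neg ((hC.convex k).inter hD) ?_ hk
  filter_upwards [hfill] with w hw hwCD h0
  exact hC.subset k hwCD.1 ⟨i, hw hwCD.2 h0, h0⟩

lemma exists_halfPlane_fill {i e : ι} (hie : e ≠ i) (hi : z.1 ∈ S.dom i)
    (hi0 : height (ℓ i) z = 0) (he : z.1 ∈ closure (S.dom e)) (he0 : height (ℓ e) z = 0) :
    ∃ κ ≠ 0, ∀ᶠ w in 𝓝 z, w ∈ halfPlane (ℓ i) κ → height (ℓ e) w = 0 → w.1 ∈ S.dom e := by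
  have hz : ℓ e z.1 = ℓ i z.1 :=
    ((height_eq_zero_iff _).1 he0).symm.trans ((height_eq_zero_iff _).1 hi0)
  have hσ : lineSlope (ℓ e) ≠ lineSlope (ℓ i) := lineSlope_ne_of_apply_eq (ℓ.injective.ne hie) hz
  obtain ⟨c, hc⟩ := S.nonempty_dom e
  have hcz : c ≠ z.1 := by
    rintro rfl
    exact hie (eq_of_mem_dom hc hi he0 hi0)
  refine ⟨(lineSlope (ℓ e) - lineSlope (ℓ i)) * (c - z.1),
    mul_ne_zero (sub_ne_zero.2 hσ) (sub_ne_zero.2 hcz), ?_⟩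
  filter_upwards [continuous_fst.continuousAt.eventually
    (eventually_mem_of_mem_closure (S.ordConnected_dom e) he hc)] with w hw hwκ hw0
  refine hw (pos_of_mul_pos_right (a := (lineSlope (ℓ e) - lineSlope (ℓ i)) ^ 2) ?_ (sq_nonneg _))
  have hwi : height (ℓ i) w = (lineSlope (ℓ e) - lineSlope (ℓ i)) * (w.1 - z.1) := by
    rw [height_apply, (height_eq_zero_iff _).1 hw0, apply_eq_add_lineSlope (ℓ e) z.1 w.1,
      apply_eq_add_lineSlope (ℓ i) z.1 w.1, hz]
    ring
  rw [halfPlane, mem_ofPred_eq, hwi] at hwκ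
  linarith

variable [Finite ι] [Finite K]

lemma exists_mem_closure_cell_inter (hC : IsConvexPartition S.carrierᶜ C) {R : Set (ℝ × ℝ)}
    (hR : IsOpen R) (hz : z ∈ closure R) : ∃ k, z ∈ closure (C k ∩ R) := by
  have hdense : R ⊆ closure (R ∩ S.carrierᶜ) := S.dense_compl_carrier.open_subset_closure_inter hR
  have hz' : z ∈ closure (R ∩ S.carrierᶜ) := closure_minimal hdense isClosed_closure hz
  rw [← hC.iUnion_eq, inter_iUnion, closure_iUnion_of_finite, mem_iUnion] at hz'
  simpa only [inter_comm] using hz'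

lemma exists_two_cells (hC : IsConvexPartition S.carrierᶜ C) (hz : z ∈ S.carrier) :
    ∃ k l, k ≠ l ∧ z ∈ closure (C k) ∧ z ∈ closure (C l) := by
  obtain ⟨i, hi, h0⟩ := hz
  have hside : ∀ κ ≠ 0, ∃ k, z ∈ closure (C k ∩ halfPlane (ℓ i) κ) := fun κ hκ =>
    exists_mem_closure_cell_inter hC (isOpen_halfPlane _ κ) (mem_closure_halfPlane hκ h0)
  obtain ⟨k, hk⟩ := hside 1 one_ne_zero
  obtain ⟨l, hl⟩ := hside (-1) (neg_ne_zero.2 one_ne_zero)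
  refine ⟨k, l, ?_, closure_mono inter_subset_left hk, closure_mono inter_subset_left hl⟩
  rintro rfl
  have hfill : ∀ᶠ w in 𝓝 z, w ∈ univ → height (ℓ i) w = 0 → w.1 ∈ S.dom i := by
    filter_upwards [continuous_fst.continuousAt.eventually_mem ((S.isOpen_dom i).mem_nhds hi)]
      with w hw _ _
    exact hw
  exact notMem_closure_both_sides (κ := 1) hC convex_univ hfill (by rwa [univ_inter])
    (by rwa [univ_inter])

/- Piece `i` separates a neighbourhood of `z` into two half planes, and piece `e` divides one of
them again. -/
lemma exists_three_cells (hC : IsConvexPartition S.carrierᶜ C) {i e : ι} (hie : e ≠ i)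
    (hi : z.1 ∈ S.dom i) (hi0 : height (ℓ i) z = 0) (he : z.1 ∈ closure (S.dom e))
    (he0 : height (ℓ e) z = 0) :
    ∃ k₁ k₂ k₃, k₁ ≠ k₂ ∧ k₁ ≠ k₃ ∧ k₂ ≠ k₃ ∧
      z ∈ closure (C k₁) ∧ z ∈ closure (C k₂) ∧ z ∈ closure (C k₃) := by
  obtain ⟨κ, hκ, hfill⟩ := exists_halfPlane_fill hie hi hi0 he he0
  have hfill_i : ∀ᶠ w in 𝓝 z, w ∈ univ → height (ℓ i) w = 0 → w.1 ∈ S.dom i := by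
    filter_upwards [continuous_fst.continuousAt.eventually_mem ((S.isOpen_dom i).mem_nhds hi)]
      with w hw _ _
    exact hw
  have hsector : ∀ τ ≠ 0, ∃ k, z ∈ closure (C k ∩ (halfPlane (ℓ i) κ ∩ halfPlane (ℓ e) τ)) :=
    fun τ hτ => exists_mem_closure_cell_inter hC
      ((isOpen_halfPlane _ κ).inter (isOpen_halfPlane _ τ))
      (mem_closure_inter_halfPlane (ℓ.injective.ne hie.symm) hi0 he0 hκ hτ)
  obtain ⟨k₁, hk₁⟩ := exists_mem_closure_cell_inter hC (isOpen_halfPlane _ (-κ))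
    (mem_closure_halfPlane (neg_ne_zero.2 hκ) hi0)
  obtain ⟨k₂, hk₂⟩ := hsector 1 one_ne_zero
  obtain ⟨k₃, hk₃⟩ := hsector (-1) (neg_ne_zero.2 one_ne_zero)
  have hsides : ∀ k τ, z ∈ closure (C k ∩ (halfPlane (ℓ i) κ ∩ halfPlane (ℓ e) τ)) → k₁ ≠ k := by
    rintro k τ hk rfl
    refine notMem_closure_both_sides (κ := κ) hC convex_univ hfill_i ?_ (by rwa [univ_inter])
    rw [univ_inter]
    exact closure_mono (inter_subset_inter_right _ inter_subset_left) hk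
  refine ⟨k₁, k₂, k₃, hsides k₂ 1 hk₂, hsides k₃ (-1) hk₃, ?_, closure_mono inter_subset_left hk₁,
    closure_mono inter_subset_left hk₂, closure_mono inter_subset_left hk₃⟩
  rintro rfl
  exact notMem_closure_both_sides (κ := 1) hC (convex_halfPlane _ κ) hfill hk₂ hk₃

lemma IsFull.min_ncard_lt_ncard_cells (hS : S.IsFull) (hC : IsConvexPartition S.carrierᶜ C) :
    min {i | z.1 ∈ closure (S.dom i) ∧ height (ℓ i) z = 0}.ncard 2 <
      {k | z ∈ closure (C k)}.ncard := by
  set T := {i | z.1 ∈ closure (S.dom i) ∧ height (ℓ i) z = 0}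
  rcases T.eq_empty_or_nonempty with hempty | ⟨j, hj⟩
  · obtain ⟨k, hk⟩ := exists_mem_closure_cell_inter hC isOpen_univ
      (subset_closure (mem_univ z))
    rw [hempty, ncard_empty, Nat.zero_min, ncard_pos]
    exact ⟨k, closure_mono inter_subset_left hk⟩
  obtain ⟨i, hi, hi0⟩ := hS j z hj.1 hj.2
  by_cases hsingle : ∃ e ∈ T, e ≠ i
  · obtain ⟨e, he, hei⟩ := hsingle
    obtain ⟨k₁, k₂, k₃, h12, h13, h23, h1, h2, h3⟩ := exists_three_cells hC hei hi hi0 he.1 he.2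
    exact (min_le_right _ _).trans_lt
      ((two_lt_ncard_iff (toFinite _)).2 ⟨k₁, k₂, k₃, h1, h2, h3, h12, h13, h23⟩)
  · obtain ⟨k, l, hkl, hk, hl⟩ := exists_two_cells hC ⟨i, hi, hi0⟩
    have hsub : T ⊆ {i} := by
      intro e he
      by_contra hei
      exact hsingle ⟨e, he, hei⟩
    have hcard : T.ncard ≤ 1 := by simpa using ncard_le_ncard hsub
    exact ((min_le_left _ _).trans hcard).trans_lt
      ((one_lt_ncard_iff (toFinite _)).2 ⟨k, l, hk, hl, hkl⟩)

end Incidence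

end Cells

end SegmentSystem

section Orientation

variable {a b c z : ℝ × ℝ}

/-- Twice the signed area of the triangle `a b c`, over any commutative ring so that explicit
configurations can be evaluated over `ℤ`. -/
def orient {R : Type*} [CommRing R] (a b c : R × R) : R :=
  (b.1 - a.1) * (c.2 - a.2) - (b.2 - a.2) * (c.1 - a.1)

lemma collinear_of_orient_eq_zero (hab : a ≠ b) (h : orient a b c = 0) :
    Collinear ℝ ({a, b, c} : Set (ℝ × ℝ)) := by
  suffices hc : ∃ r : ℝ, c = r • (b - a) + a by
    rw [collinear_iff_of_mem (p₀ := a) (by simp)]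
    refine ⟨b - a, ?_⟩
    rintro q (rfl | rfl | rfl)
    · exact ⟨0, by simp⟩
    · exact ⟨1, by simp⟩
    · exact hc
  rw [orient, sub_eq_zero] at h
  by_cases h1 : b.1 - a.1 = 0
  · have h2 : b.2 - a.2 ≠ 0 := fun h2 => hab (Prod.ext (by linarith) (by linarith))
    have h3 : c.1 - a.1 = 0 := by simpa [h1, h2] using h.symm
    refine ⟨(c.2 - a.2) / (b.2 - a.2), Prod.ext ?_ ?_⟩
    · simp only [Prod.fst_add, Prod.smul_fst, Prod.fst_sub, h1, smul_zero]
      linarith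
    · simp [h2]
  · refine ⟨(c.1 - a.1) / (b.1 - a.1), Prod.ext ?_ ?_⟩
    · simp [h1]
    · simp only [Prod.snd_add, Prod.smul_snd, Prod.snd_sub, smul_eq_mul]
      field_simp
      linarith

lemma orient_eq_zero_of_collinear (h : Collinear ℝ ({a, b, c} : Set (ℝ × ℝ))) :
    orient a b c = 0 := by
  rw [collinear_iff_of_mem (p₀ := a) (by simp)] at h
  obtain ⟨v, hv⟩ := h
  obtain ⟨r, rfl⟩ := hv b (by simp)
  obtain ⟨s, rfl⟩ := hv c (by simp)
  simp only [orient, vadd_eq_add, Prod.fst_add, Prod.snd_add, Prod.smul_fst, Prod.smul_snd,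
    smul_eq_mul]
  ring

lemma orient_eq_zero_of_height_eq_zero {l : ℝ →ᵃ[ℝ] ℝ} (ha : height l a = 0) (hb : height l b = 0)
    (hc : height l c = 0) : orient a b c = 0 := by
  rw [height_eq_zero_iff, apply_eq_add_lineSlope l 0] at ha hb hc
  rw [orient, ha, hb, hc]
  ring

lemma exists_height_eq_zero (h : a.1 ≠ b.1) : ∃ l, height l a = 0 ∧ height l b = 0 := by
  have h' : b.1 - a.1 ≠ 0 := sub_ne_zero.2 h.symm
  refine ⟨((b.2 - a.2) / (b.1 - a.1)) • (AffineMap.id ℝ ℝ - AffineMap.const ℝ ℝ a.1) +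
    AffineMap.const ℝ ℝ a.2, ?_, ?_⟩
  · simp [height_eq_zero_iff]
  · simp [height_eq_zero_iff, h']

variable {l : ℝ →ᵃ[ℝ] ℝ}

lemma height_eq_zero_of_mem_segment (ha : height l a = 0) (hb : height l b = 0)
    (hz : z ∈ segment ℝ a b) : height l z = 0 :=
  ((convex_singleton (0 : ℝ)).affine_preimage (height l)).segment_subset ha hb hz

lemma mk_mem_openSegment (ha : height l a = 0) (hb : height l b = 0) {x : ℝ}
    (hx : x ∈ openSegment ℝ a.1 b.1) : (x, l x) ∈ openSegment ℝ a b := by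
  have hgraph := image_openSegment ℝ ((AffineMap.id ℝ ℝ).prod l) a.1 b.1
  simp only [AffineMap.prod_apply, AffineMap.id_apply, ← (height_eq_zero_iff l).1 ha,
    ← (height_eq_zero_iff l).1 hb] at hgraph
  exact hgraph ▸ mem_image_of_mem _ hx

end Orientation

section Drawing

variable {V : Type*} {p : V → ℝ × ℝ} {H : SimpleGraph V}

/-- No three points of the family `p` are collinear. -/
def GeneralPosition (p : V → ℝ × ℝ) : Prop :=
  ∀ u v w, u ≠ v → v ≠ w → u ≠ w → orient (p u) (p v) (p w) ≠ 0

lemma GeneralPosition.edge_eq_of_height_eq_zero (hp : GeneralPosition p) {e f : Sym2 V}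
    (he : ¬ e.IsDiag) (hf : ¬ f.IsDiag) {l : ℝ →ᵃ[ℝ] ℝ} (hel : ∀ u ∈ e, height l (p u) = 0)
    (hfl : ∀ u ∈ f, height l (p u) = 0) : e = f := by
  induction e using Sym2.ind with | _ a b => ?_
  induction f using Sym2.ind with | _ c d => ?_
  rw [Sym2.mk_isDiag_iff] at he hf
  have hmem : ∀ w, height l (p w) = 0 → w ∈ s(a, b) := by
    intro w hw
    by_contra hwab
    rw [Sym2.mem_iff, not_or] at hwab
    exact hp a b w he (Ne.symm hwab.2) (Ne.symm hwab.1) (orient_eq_zero_of_height_eq_zero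
      (hel a (Sym2.mem_mk_left a b)) (hel b (Sym2.mem_mk_right a b)) hw)
  exact (Sym2.mem_and_mem_iff hf).1
    ⟨hmem c (hfl c (Sym2.mem_mk_left c d)), hmem d (hfl d (Sym2.mem_mk_right c d))⟩

lemma IsNoncrossing.line_apply_ne (hH : IsNoncrossing p H) {u v x y : V} (huv : H.Adj u v)
    (hxy : H.Adj x y) (hne : s(u, v) ≠ s(x, y)) (hvert : (p u).1 ≠ (p v).1) {l m : ℝ →ᵃ[ℝ] ℝ}
    (hu : height l (p u) = 0) (hv : height l (p v) = 0) (hx : height m (p x) = 0)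
    (hy : height m (p y) = 0) {t : ℝ} (ht : t ∈ openSegment ℝ (p u).1 (p v).1)
    (ht' : t ∈ openSegment ℝ (p x).1 (p y).1) : l t ≠ m t := by
  intro h
  have hl : (t, l t) ∈ segment ℝ (p u) (p v) :=
    openSegment_subset_segment ℝ _ _ (mk_mem_openSegment hu hv ht)
  have hm : (t, l t) ∈ segment ℝ (p x) (p y) :=
    h ▸ openSegment_subset_segment ℝ _ _ (mk_mem_openSegment hx hy ht')
  obtain ⟨w, ⟨hw, -⟩, hpw⟩ := hH u v x y huv hxy hne ⟨hl, hm⟩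
  obtain rfl : (p w).1 = t := congrArg Prod.fst hpw
  rcases hw with rfl | rfl
  · exact hvert (left_mem_openSegment_iff.1 ht)
  · exact hvert (right_mem_openSegment_iff.1 ht)

lemma exists_forall_mem_height_eq_zero (hvert : ∀ u v, H.Adj u v → (p u).1 ≠ (p v).1)
    (e : H.edgeSet) : ∃ l, ∀ u ∈ e.1, height l (p u) = 0 := by
  obtain ⟨⟨u, v⟩, he⟩ := e
  obtain ⟨l, hu, hv⟩ := exists_height_eq_zero (hvert u v he)
  refine ⟨l, fun w hw => ?_⟩
  rcases Sym2.mem_iff.1 hw with rfl | rfl <;> assumption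

lemma exists_eq_openSegment_of_mk_eq (p : V → ℝ × ℝ) (e : Sym2 V) :
    ∃ D : Set ℝ, ∀ u v, s(u, v) = e → D = openSegment ℝ (p u).1 (p v).1 := by
  obtain ⟨u, v⟩ := e
  refine ⟨openSegment ℝ (p u).1 (p v).1, fun x y hxy => ?_⟩
  rcases Sym2.eq_iff.1 hxy with ⟨rfl, rfl⟩ | ⟨rfl, rfl⟩
  · rfl
  · exact openSegment_symm ℝ _ _

lemma exists_segmentSystem (hvert : ∀ u v, H.Adj u v → (p u).1 ≠ (p v).1)
    (hp : GeneralPosition p) (hH : IsNoncrossing p H) :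
    ∃ (ℓ : H.edgeSet ↪ (ℝ →ᵃ[ℝ] ℝ)) (S : SegmentSystem ℓ), ∀ e u v, s(u, v) = e.1 →
      height (ℓ e) (p u) = 0 ∧ S.dom e = openSegment ℝ (p u).1 (p v).1 := by
  have hrep : ∀ e : H.edgeSet, ∃ u v, H.Adj u v ∧ s(u, v) = e.1 := by
    rintro ⟨⟨u, v⟩, he⟩
    exact ⟨u, v, he, rfl⟩
  choose l hl using exists_forall_mem_height_eq_zero hvert
  choose D hD using fun e : H.edgeSet => exists_eq_openSegment_of_mk_eq p e.1
  have hl_inj : Function.Injective l := fun e f hef => Subtype.ext <|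
    hp.edge_eq_of_height_eq_zero (H.not_isDiag_of_mem_edgeSet e.2)
      (H.not_isDiag_of_mem_edgeSet f.2) (hl e) (hef ▸ hl f)
  refine ⟨⟨l, hl_inj⟩, ⟨D, fun e => ?_, fun e => ?_, fun e => ?_, fun e f x hef hxe hxf => ?_⟩,
    fun e u v he => ⟨hl e u (he ▸ Sym2.mem_mk_left u v), hD e u v he⟩⟩
  · obtain ⟨u, v, huv, he⟩ := hrep e
    rw [hD e u v he, openSegment_eq_Ioo' (hvert u v huv)]
    exact isOpen_Ioo
  · obtain ⟨u, v, -, he⟩ := hrep e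
    rw [hD e u v he]
    exact (convex_openSegment _ _).ordConnected
  · obtain ⟨u, v, -, he⟩ := hrep e
    rw [hD e u v he]
    exact ⟨_, midpoint_mem_openSegment _ _⟩
  · obtain ⟨u, v, huv, he⟩ := hrep e
    obtain ⟨x, y, hxy, hf⟩ := hrep f
    rw [hD e u v he] at hxe
    rw [hD f x y hf] at hxf
    refine hH.line_apply_ne huv hxy ?_ (hvert u v huv) (hl e u ?_) (hl e v ?_) (hl f x ?_)
      (hl f y ?_) hxe hxf
    · rw [he, hf]
      exact Subtype.coe_injective.ne hef
    all_goals simp [← he, ← hf]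

/-- A decomposition of the complement of a drawing: disjoint convex cells that avoid all edges and
crowd around each vertex, a vertex of degree `d` being on the boundary of more than `min d 2`
cells. -/
structure IsCellDecomposition {K : Type*} (p : V → ℝ × ℝ) (H : SimpleGraph V)
    (C : K → Set (ℝ × ℝ)) : Prop where
  convex : ∀ k, Convex ℝ (C k)
  disjoint : Pairwise fun k l => Disjoint (C k) (C l)
  disjoint_edge : ∀ u v, H.Adj u v → ∀ k, Disjoint (openSegment ℝ (p u) (p v)) (C k)
  min_degree_lt : ∀ v, min (H.neighborSet v).ncard 2 < {k | p v ∈ closure (C k)}.ncard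

lemma exists_isCellDecomposition_of_not_vertical [Finite V]
    (hvert : ∀ u v, H.Adj u v → (p u).1 ≠ (p v).1) (hp : GeneralPosition p)
    (hH : IsNoncrossing p H) :
    ∃ (K : Type) (_ : Finite K) (C : K → Set (ℝ × ℝ)), Nat.card K ≤ H.edgeSet.ncard + 1 ∧
      IsCellDecomposition p H C := by
  obtain ⟨ℓ, S₀, hS₀⟩ := exists_segmentSystem hvert hp hH
  obtain ⟨S, hle, hS⟩ := S₀.exists_le_isFull
  obtain ⟨K, hK, C, hcard, hC⟩ := hS.exists_isConvexPartition
  refine ⟨K, hK, C, hcard, hC.convex, hC.disjoint, fun u v huv k => ?_, fun v => ?_⟩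
  · refine disjoint_left.2 fun z hz hzC => hC.subset k hzC ⟨⟨s(u, v), huv⟩, hle _ ?_, ?_⟩
    · rw [(hS₀ _ u v rfl).2]
      exact image_openSegment ℝ AffineMap.fst (p u) (p v) ▸ mem_image_of_mem _ hz
    · exact height_eq_zero_of_mem_segment (hS₀ _ u v rfl).1 (hS₀ _ v u Sym2.eq_swap).1
        (openSegment_subset_segment ℝ _ _ hz)
  · refine lt_of_le_of_lt (min_le_min_right 2 ?_) (hS.min_ncard_lt_ncard_cells hC)
    rw [← ncard_image_of_injective _ (Sym2.mkEmbedding v).injective,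
      ← ncard_image_of_injective _ (Subtype.val_injective (p := (· ∈ H.edgeSet)))]
    refine ncard_le_ncard ?_
    rintro _ ⟨w, hvw, rfl⟩
    refine ⟨⟨s(v, w), hvw⟩, ⟨closure_mono (hle _) ?_, (hS₀ _ v w rfl).1⟩, rfl⟩
    rw [(hS₀ _ v w rfl).2]
    exact segment_subset_closure_openSegment (left_mem_segment ℝ _ _)

/-- The shear `(x, y) ↦ (x + s y, y)`, used to make all edges of a drawing non-vertical. -/
noncomputable def shear (s : ℝ) : (ℝ × ℝ) ≃L[ℝ] (ℝ × ℝ) :=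
  LinearEquiv.toContinuousLinearEquiv
    { toFun := fun z => (z.1 + s * z.2, z.2)
      invFun := fun z => (z.1 - s * z.2, z.2)
      map_add' := fun z w => by ext <;> simp; ring
      map_smul' := fun c z => by ext <;> simp; ring
      left_inv := fun z => by ext <;> simp
      right_inv := fun z => by ext <;> simp }

lemma shear_apply (s : ℝ) (z : ℝ × ℝ) : shear s z = (z.1 + s * z.2, z.2) := rfl

lemma orient_shear (s : ℝ) (a b c : ℝ × ℝ) :
    orient (shear s a) (shear s b) (shear s c) = orient a b c := by
  simp only [orient, shear_apply]
  ring

lemma exists_shear_not_vertical [Finite V] (hp : Function.Injective p) :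
    ∃ s, ∀ u v, u ≠ v → (shear s (p u)).1 ≠ (shear s (p v)).1 := by
  have hfin : (⋃ a : V × V, {s : ℝ | a.1 ≠ a.2 ∧
      (shear s (p a.1)).1 = (shear s (p a.2)).1}).Finite := by
    refine finite_iUnion fun a => Set.Subsingleton.finite ?_
    rintro s ⟨hne, hs⟩ t ⟨-, ht⟩
    simp only [shear_apply] at hs ht
    by_contra hst
    have hy : (p a.1).2 = (p a.2).2 := mul_left_cancel₀ (sub_ne_zero.2 hst) (by linarith)
    exact hne (hp (Prod.ext (by rw [hy] at hs; linarith) hy))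
  obtain ⟨s, hs⟩ := hfin.exists_notMem
  exact ⟨s, fun u v huv h => hs (mem_iUnion.2 ⟨(u, v), huv, h⟩)⟩

lemma IsNoncrossing.map (hH : IsNoncrossing p H) (L : (ℝ × ℝ) →ᵃ[ℝ] (ℝ × ℝ))
    (hL : Function.Injective L) : IsNoncrossing (L ∘ p) H := by
  intro u v x y huv hxy hne
  rw [image_comp, Function.comp_apply, Function.comp_apply, Function.comp_apply,
    Function.comp_apply, ← image_segment, ← image_segment, ← image_inter hL]
  exact image_mono (hH u v x y huv hxy hne)

lemma IsCellDecomposition.preimage {K : Type*} {C : K → Set (ℝ × ℝ)}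
    (L : (ℝ × ℝ) ≃L[ℝ] (ℝ × ℝ)) (hC : IsCellDecomposition (L ∘ p) H C) :
    IsCellDecomposition p H fun k => L ⁻¹' C k where
  convex k := (hC.convex k).linear_preimage (L : (ℝ × ℝ) →ₗ[ℝ] (ℝ × ℝ))
  disjoint k l hkl := (hC.disjoint hkl).preimage L
  disjoint_edge u v huv k := by
    have himage : L '' openSegment ℝ (p u) (p v) = openSegment ℝ (L (p u)) (L (p v)) :=
      image_openSegment ℝ (L : (ℝ × ℝ) →ₗ[ℝ] (ℝ × ℝ)).toAffineMap (p u) (p v)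
    exact disjoint_image_left.1 (himage ▸ hC.disjoint_edge u v huv k)
  min_degree_lt v := by
    refine (hC.min_degree_lt v).trans_eq (congrArg ncard ?_)
    ext k
    exact Set.ext_iff.1 (L.toHomeomorph.preimage_closure (C k)) (p v)

theorem exists_isCellDecomposition [Finite V] (hinj : Function.Injective p)
    (hp : GeneralPosition p) (hH : IsNoncrossing p H) :
    ∃ (K : Type) (_ : Finite K) (C : K → Set (ℝ × ℝ)), Nat.card K ≤ H.edgeSet.ncard + 1 ∧
      IsCellDecomposition p H C := by
  obtain ⟨s, hs⟩ := exists_shear_not_vertical hinj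
  obtain ⟨K, hK, C, hcard, hC⟩ := exists_isCellDecomposition_of_not_vertical (p := shear s ∘ p)
    (fun u v huv => hs u v huv.ne)
    (fun u v w huv hvw huw => (orient_shear s _ _ _).trans_ne (hp u v w huv hvw huw))
    (hH.map (shear s : (ℝ × ℝ) →ₗ[ℝ] (ℝ × ℝ)).toAffineMap (shear s).injective)
  exact ⟨K, hK, _, hcard, hC.preimage (shear s)⟩

end Drawing

section Convexity

variable {E : Type*} [NormedAddCommGroup E] [NormedSpace ℝ E] [FiniteDimensional ℝ E]
  {C D T : Set E}

lemma affineSpan_closure (C : Set E) : affineSpan ℝ (closure C) = affineSpan ℝ C :=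
  le_antisymm
    (affineSpan_le.2 <| closure_minimal (subset_affineSpan ℝ C)
      (affineSpan ℝ C).closed_of_finiteDimensional)
    (affineSpan_mono ℝ subset_closure)

lemma interior_convexHull_subset_of_subset_closure (hC : Convex ℝ C) (hT : affineSpan ℝ T = ⊤)
    (hTC : T ⊆ closure C) : interior (convexHull ℝ T) ⊆ C := by
  have hspan : affineSpan ℝ C = ⊤ := by
    rw [← affineSpan_closure, eq_top_iff, ← hT]
    exact affineSpan_mono ℝ hTC
  have hint : (interior C).Nonempty := hC.interior_nonempty_iff_affineSpan_eq_top.2 hspan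
  calc interior (convexHull ℝ T) ⊆ interior (closure C) :=
        interior_mono (convexHull_min hTC hC.closure)
    _ = interior C := hC.interior_closure_eq_interior_of_nonempty_interior hint
    _ ⊆ C := interior_subset

lemma nonempty_inter_of_subset_closure (hC : Convex ℝ C) (hD : Convex ℝ D)
    (hT : affineSpan ℝ T = ⊤) (hTC : T ⊆ closure C) (hTD : T ⊆ closure D) : (C ∩ D).Nonempty :=
  (interior_convexHull_nonempty_iff_affineSpan_eq_top.2 hT).mono <| subset_inter
    (interior_convexHull_subset_of_subset_closure hC hT hTC)
    (interior_convexHull_subset_of_subset_closure hD hT hTD)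

end Convexity

section Crossing

variable {a b c d z : ℝ × ℝ}

lemma affineSpan_eq_top_of_orient_ne_zero (h : orient a b c ≠ 0) :
    affineSpan ℝ ({a, b, c} : Set (ℝ × ℝ)) = ⊤ := by
  have hind : AffineIndependent ℝ ![a, b, c] := by
    rw [affineIndependent_iff_not_collinear_set]
    exact fun hcol => h (orient_eq_zero_of_collinear hcol)
  have hspan := hind.affineSpan_eq_top_iff_card_eq_finrank_add_one.2 (by simp)
  rwa [Matrix.range_cons, Matrix.range_cons_cons_empty, singleton_union] at hspan

lemma orient_lineMap (a b c d : ℝ × ℝ) (t : ℝ) :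
    orient a b (AffineMap.lineMap c d t) = (1 - t) * orient a b c + t * orient a b d := by
  simp only [orient, AffineMap.lineMap_apply_module, Prod.fst_add, Prod.snd_add, Prod.smul_fst,
    Prod.smul_snd, smul_eq_mul]
  ring

lemma orient_self_right (a b : ℝ × ℝ) : orient a b b = 0 := by
  rw [orient]; ring

lemma orient_self_outer (a b : ℝ × ℝ) : orient a b a = 0 := by
  rw [orient]; ring

lemma orient_eq_zero_of_mem_segment (hz : z ∈ segment ℝ a b) : orient a b z = 0 := by
  rw [segment_eq_image_lineMap] at hz
  obtain ⟨t, -, rfl⟩ := hz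
  rw [orient_lineMap, orient_self_outer, orient_self_right, mul_zero, mul_zero, add_zero]

lemma eq_of_mem_segment_of_mem_segment (h : orient a b c ≠ 0) (hz : z ∈ segment ℝ a b)
    (hz' : z ∈ segment ℝ a c) : z = a := by
  rw [segment_eq_image_lineMap] at hz'
  obtain ⟨t, -, rfl⟩ := hz'
  have h0 := orient_eq_zero_of_mem_segment hz
  rw [orient_lineMap, orient_self_outer, mul_zero, zero_add] at h0
  rw [(mul_eq_zero.1 h0).resolve_right h, AffineMap.lineMap_apply_zero]

/-- The open segments `a b` and `c d` cross properly: the end points of each lie strictly on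
different sides of the line spanned by the other. -/
def Crosses {R : Type*} [CommRing R] [LinearOrder R] (a b c d : R × R) : Prop :=
  orient a b c * orient a b d < 0 ∧ orient c d a * orient c d b < 0

lemma sub_ne_zero_and_div_sub_mem_Ioo {x y : ℝ} (h : x * y < 0) :
    x - y ≠ 0 ∧ x / (x - y) ∈ Ioo (0 : ℝ) 1 := by
  rcases mul_neg_iff.1 h with ⟨hx, hy⟩ | ⟨hx, hy⟩
  · have hxy : 0 < x - y := by linarith
    exact ⟨hxy.ne', div_pos hx hxy, (div_lt_one hxy).2 (by linarith)⟩
  · have hxy : x - y < 0 := by linarith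
    exact ⟨hxy.ne, div_pos_of_neg_of_neg hx hxy, (div_lt_one_of_neg hxy).2 (by linarith)⟩

lemma lineMap_orient_eq_lineMap_orient (h : orient a b c - orient a b d ≠ 0)
    (h' : orient c d a - orient c d b ≠ 0) :
    AffineMap.lineMap c d (orient a b c / (orient a b c - orient a b d)) =
      AffineMap.lineMap a b (orient c d a / (orient c d a - orient c d b)) := by
  ext <;>
  · simp only [AffineMap.lineMap_apply_module, Prod.fst_add, Prod.snd_add, Prod.smul_fst,
      Prod.smul_snd, smul_eq_mul]
    field_simp
    simp only [orient]
    ring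

lemma Crosses.exists_mem_openSegment (h : Crosses a b c d) :
    ∃ z, z ∈ openSegment ℝ a b ∧ z ∈ openSegment ℝ c d := by
  obtain ⟨hab, hab'⟩ := sub_ne_zero_and_div_sub_mem_Ioo h.1
  obtain ⟨hcd, hcd'⟩ := sub_ne_zero_and_div_sub_mem_Ioo h.2
  simp only [openSegment_eq_image_lineMap]
  exact ⟨_, ⟨_, hcd', rfl⟩, ⟨_, hab', lineMap_orient_eq_lineMap_orient hab hcd⟩⟩

lemma orient_mul_orient_neg_of_mem_segment (hz : z ∈ segment ℝ a b) (hz' : z ∈ segment ℝ c d)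
    (hc : orient a b c ≠ 0) (hd : orient a b d ≠ 0) : orient a b c * orient a b d < 0 := by
  rw [segment_eq_image_lineMap] at hz'
  obtain ⟨t, ⟨ht0, ht1⟩, rfl⟩ := hz'
  have h0 := orient_eq_zero_of_mem_segment hz
  rw [orient_lineMap] at h0
  refine lt_of_le_of_ne ?_ (mul_ne_zero hc hd)
  by_contra! hpos
  have hd2 : 0 < orient a b d ^ 2 := by positivity
  have hsum : (1 - t) * (orient a b c * orient a b d) + t * orient a b d ^ 2 = 0 := by
    linear_combination orient a b d * h0
  rcases ht0.eq_or_lt with rfl | ht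
  · linarith
  · linarith [mul_nonneg (sub_nonneg.2 ht1) hpos.le, mul_pos ht hd2]

lemma crosses_of_mem_segment (hz : z ∈ segment ℝ a b) (hz' : z ∈ segment ℝ c d)
    (hc : orient a b c ≠ 0) (hd : orient a b d ≠ 0) (ha : orient c d a ≠ 0)
    (hb : orient c d b ≠ 0) : Crosses a b c d :=
  ⟨orient_mul_orient_neg_of_mem_segment hz hz' hc hd,
    orient_mul_orient_neg_of_mem_segment hz' hz ha hb⟩

lemma isOpen_setOf_crosses :
    IsOpen {w : (ℝ × ℝ) × (ℝ × ℝ) × (ℝ × ℝ) × (ℝ × ℝ) | Crosses w.1 w.2.1 w.2.2.1 w.2.2.2} := by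
  simp only [Crosses, orient]
  refine IsOpen.and ?_ ?_ <;> exact isOpen_lt (by fun_prop) continuous_const

end Crossing

section Cells

variable {V K : Type*} {p : V → ℝ × ℝ} {H : SimpleGraph V} {C : K → Set (ℝ × ℝ)} {u v x y : V}

lemma GeneralPosition.inter_subset_of_common_endpoint (hp : GeneralPosition p) (huv : u ≠ v)
    (hxy : x ≠ y) (hne : s(u, v) ≠ s(x, y)) (hcom : u = x ∨ u = y ∨ v = x ∨ v = y) :
    segment ℝ (p u) (p v) ∩ segment ℝ (p x) (p y) ⊆ p '' (({u, v} : Set V) ∩ {x, y}) := by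
  rintro z ⟨hz, hz'⟩
  have hcorner : ∀ a b c : V, a ≠ b → a ≠ c → b ≠ c → z ∈ segment ℝ (p a) (p b) →
      z ∈ segment ℝ (p a) (p c) → p a = z := fun a b c hab hac hbc h h' =>
    (eq_of_mem_segment_of_mem_segment (hp a b c hab hbc hac) h h').symm
  rcases hcom with rfl | rfl | rfl | rfl
  · exact ⟨u, by simp, hcorner u v y huv hxy (fun h => hne (by rw [h])) hz hz'⟩
  · rw [segment_symm] at hz'
    exact ⟨u, by simp, hcorner u v x huv hxy.symm (fun h => hne (by rw [h, Sym2.eq_swap])) hz hz'⟩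
  · rw [segment_symm] at hz
    exact ⟨v, by simp, hcorner v u y huv.symm hxy (fun h => hne (by rw [h, Sym2.eq_swap])) hz hz'⟩
  · rw [segment_symm] at hz hz'
    exact ⟨v, by simp, hcorner v u x huv.symm hxy.symm (fun h => hne (by rw [h])) hz hz'⟩

lemma GeneralPosition.crosses_of_mem_segment (hp : GeneralPosition p) (huv : u ≠ v) (hxy : x ≠ y)
    (hux : u ≠ x) (huy : u ≠ y) (hvx : v ≠ x) (hvy : v ≠ y) {z : ℝ × ℝ}
    (hz : z ∈ segment ℝ (p u) (p v)) (hz' : z ∈ segment ℝ (p x) (p y)) :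
    Crosses (p u) (p v) (p x) (p y) :=
  _root_.crosses_of_mem_segment hz hz' (hp u v x huv hvx hux) (hp u v y huv hvy huy)
    (hp x y u hxy huy.symm hux.symm) (hp x y v hxy hvy.symm hvx.symm)

lemma IsCellDecomposition.not_crosses (hC : IsCellDecomposition p H C) {a b : ℝ × ℝ} {k : K}
    (ha : a ∈ closure (C k)) (hb : b ∈ closure (C k)) (hxy : H.Adj x y) :
    ¬ Crosses a b (p x) (p y) := by
  intro hcross
  have hcont : Continuous fun w : (ℝ × ℝ) × (ℝ × ℝ) => (w.1, w.2, p x, p y) := by fun_prop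
  have hmem : (a, b) ∈ closure (C k ×ˢ C k) := by
    rw [closure_prod_eq]
    exact ⟨ha, hb⟩
  obtain ⟨⟨a', b'⟩, hcross', ha', hb'⟩ :=
    mem_closure_iff.1 hmem _ (isOpen_setOf_crosses.preimage hcont) hcross
  obtain ⟨w, hw, hw'⟩ := Crosses.exists_mem_openSegment hcross'
  exact disjoint_left.1 (hC.disjoint_edge x y hxy k) hw'
    ((hC.convex k).segment_subset ha' hb' (openSegment_subset_segment ℝ _ _ hw))

lemma IsCellDecomposition.inter_subset (hC : IsCellDecomposition p H C) (hp : GeneralPosition p)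
    (huv : u ≠ v) {k : K} (hu : p u ∈ closure (C k)) (hv : p v ∈ closure (C k)) (hxy : H.Adj x y)
    (hne : s(u, v) ≠ s(x, y)) :
    segment ℝ (p u) (p v) ∩ segment ℝ (p x) (p y) ⊆ p '' (({u, v} : Set V) ∩ {x, y}) := by
  by_cases hcom : u = x ∨ u = y ∨ v = x ∨ v = y
  · exact hp.inter_subset_of_common_endpoint huv hxy.ne hne hcom
  push Not at hcom
  obtain ⟨hux, huy, hvx, hvy⟩ := hcom
  rintro z ⟨hz, hz'⟩
  exact absurd (hp.crosses_of_mem_segment huv hxy.ne hux huy hvx hvy hz hz')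
    (hC.not_crosses hu hv hxy)

lemma IsCellDecomposition.eq_of_mem_closure (hC : IsCellDecomposition p H C)
    (hp : GeneralPosition p) {w : V} (huv : u ≠ v) (hvw : v ≠ w) (huw : u ≠ w) {k l : K}
    (hk : ({p u, p v, p w} : Set (ℝ × ℝ)) ⊆ closure (C k))
    (hl : ({p u, p v, p w} : Set (ℝ × ℝ)) ⊆ closure (C l)) : k = l := by
  by_contra hkl
  exact (nonempty_inter_of_subset_closure (hC.convex k) (hC.convex l)
    (affineSpan_eq_top_of_orient_ne_zero (hp u v w huv hvw huw)) hk hl).ne_empty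
    (hC.disjoint hkl).inter_eq

lemma IsNoncrossing.sup_edge (hH : IsNoncrossing p H)
    (hnew : ∀ x y, H.Adj x y → s(u, v) ≠ s(x, y) →
      segment ℝ (p u) (p v) ∩ segment ℝ (p x) (p y) ⊆ p '' (({u, v} : Set V) ∩ {x, y})) :
    IsNoncrossing p (H ⊔ SimpleGraph.edge u v) := by
  have hadj : ∀ {a b}, (SimpleGraph.edge u v).Adj a b → s(a, b) = s(u, v) := fun h =>
    Sym2.eq_iff.2 ((SimpleGraph.edge_adj _ _ _ _).1 h).1
  have hnew' : ∀ a b, s(a, b) = s(u, v) → ∀ x y, H.Adj x y → s(a, b) ≠ s(x, y) →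
      segment ℝ (p a) (p b) ∩ segment ℝ (p x) (p y) ⊆ p '' (({a, b} : Set V) ∩ {x, y}) := by
    intro a b hab x y hxy hne
    rcases Sym2.eq_iff.1 hab with ⟨rfl, rfl⟩ | ⟨rfl, rfl⟩
    · exact hnew x y hxy hne
    · rw [segment_symm, pair_comm]
      exact hnew x y hxy (by rwa [Sym2.eq_swap])
  rintro a b x y (hab | hab) (hxy | hxy) hne
  · exact hH a b x y hab hxy hne
  · rw [inter_comm, inter_comm {a, b}]
    exact hnew' x y (hadj hxy) a b hab hne.symm
  · exact hnew' a b (hadj hab) x y hxy hne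
  · exact absurd ((hadj hab).trans (hadj hxy).symm) hne

end Cells

section Counting

variable {V K : Type*} [Fintype K] {G : SimpleGraph V} {d : ℕ} {s U : Finset V} {inc : K → Finset V}

open Classical in
/-- A family of cliques `inc k` inside a vertex set `U`, determined by `inc k` when it has at least
three members, such that every vertex of `U` lies in more than `d` of them. The vertices left
unmatched by a maximal compatible matching of a `d`-regular geometric graph form such a family with
the cells of the plane: `inc k` consists of the unmatched vertices on the boundary of the cell
`k`. -/
structure IsCliqueFamily (G : SimpleGraph V) (d : ℕ) (U : Finset V) (inc : K → Finset V) :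
    Prop where
  subset : ∀ k, inc k ⊆ U
  isClique : ∀ k, G.IsClique (inc k)
  eq_of_eq : ∀ k l, 3 ≤ (inc k).card → inc k = inc l → k = l
  lt_card : ∀ v ∈ U, d < (Finset.univ.filter fun k => v ∈ inc k).card

open Classical in
lemma IsCliqueFamily.mul_card_le_sum_card (h : IsCliqueFamily G d U inc) :
    (d + 1) * U.card ≤ ∑ k, (inc k).card :=
  calc (d + 1) * U.card = ∑ _v ∈ U, (d + 1) := by
        rw [Finset.sum_const, smul_eq_mul, mul_comm]
    _ ≤ ∑ v ∈ U, (Finset.univ.filter fun k => v ∈ inc k).card :=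
        Finset.sum_le_sum h.lt_card
    _ = ∑ k, (U.filter fun v => v ∈ inc k).card :=
        Finset.sum_card_bipartiteAbove_eq_sum_card_bipartiteBelow fun v k => v ∈ inc k
    _ = ∑ k, (inc k).card := by
        simp only [Finset.filter_mem_eq_inter, Finset.inter_eq_right.2 (h.subset _)]

variable [Fintype V]

open Classical in
lemma subset_insert_neighborFinset (hs : G.IsClique s) {u : V} (hu : u ∈ s) :
    s ⊆ insert u (G.neighborFinset u) := by
  intro v hv
  rcases eq_or_ne v u with rfl | hvu
  · exact Finset.mem_insert_self _ _
  · exact Finset.mem_insert_of_mem ((G.mem_neighborFinset u v).2 (hs hu hv hvu.symm))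

open Classical in
lemma card_insert_neighborFinset_le (hG : G.IsRegularOfDegree d) (u : V) :
    (insert u (G.neighborFinset u)).card ≤ d + 1 := by
  rw [← hG u, ← G.card_neighborFinset_eq_degree]
  exact Finset.card_insert_le _ _

open Classical in
lemma card_le_of_isClique (hG : G.IsRegularOfDegree d) (hs : G.IsClique s) : s.card ≤ d + 1 := by
  rcases s.eq_empty_or_nonempty with rfl | ⟨u, hu⟩
  · simp
  · exact (Finset.card_le_card (subset_insert_neighborFinset hs hu)).trans
      (card_insert_neighborFinset_le hG u)

open Classical in
lemma eq_insert_neighborFinset (hG : G.IsRegularOfDegree d) (hs : G.IsClique s)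
    (hcard : s.card = d + 1) {u : V} (hu : u ∈ s) : s = insert u (G.neighborFinset u) :=
  Finset.eq_of_subset_of_card_le (subset_insert_neighborFinset hs hu)
    (hcard ▸ card_insert_neighborFinset_le hG u)

namespace IsCliqueFamily

open Classical in
lemma card_le_card (h : IsCliqueFamily G d U inc) (hG : G.IsRegularOfDegree d) :
    U.card ≤ Fintype.card K := by
  have hsum : ∑ k, (inc k).card ≤ Fintype.card K * (d + 1) :=
    Finset.sum_le_card_nsmul _ _ _ fun k _ =>
      card_le_of_isClique hG (h.isClique k)
  refine Nat.le_of_mul_le_mul_left ?_ d.succ_pos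
  rw [Nat.succ_eq_add_one, mul_comm (d + 1) (Fintype.card K)]
  exact h.mul_card_le_sum_card.trans hsum

-- A clique with `d + 1` members in a `d`-regular graph is a connected component.
open Classical in
lemma mul_card_filter_le_card (h : IsCliqueFamily G d U inc) (hG : G.IsRegularOfDegree d)
    (hd : 2 ≤ d) : (d + 1) * (Finset.univ.filter fun k => (inc k).card = d + 1).card ≤ U.card := by
  have hdisj : ((Finset.univ.filter fun k => (inc k).card = d + 1 : Finset K) :
      Set K).PairwiseDisjoint inc := by
    intro k hk l hl hkl
    have hk' : (inc k).card = d + 1 := (Finset.mem_filter.1 hk).2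
    have hl' : (inc l).card = d + 1 := (Finset.mem_filter.1 hl).2
    refine Finset.disjoint_left.2 fun u huk hul => hkl (h.eq_of_eq k l (by omega) ?_)
    rw [eq_insert_neighborFinset hG (h.isClique k) hk' huk,
      eq_insert_neighborFinset hG (h.isClique l) hl' hul]
  rw [mul_comm, ← Finset.sum_const_nat fun k hk => (Finset.mem_filter.1 hk).2,
    ← Finset.card_biUnion hdisj]
  exact Finset.card_le_card (Finset.biUnion_subset.2 fun k _ => h.subset k)

open Classical in
lemma four_mul_card_le (h : IsCliqueFamily G 2 U inc) (hG : G.IsRegularOfDegree 2) :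
    4 * U.card ≤ 3 * Fintype.card K := by
  have hfull := h.mul_card_filter_le_card hG le_rfl
  have hsum : ∑ k, (inc k).card ≤
      2 * Fintype.card K + (Finset.univ.filter fun k => (inc k).card = 2 + 1).card :=
    calc ∑ k, (inc k).card ≤ ∑ k, (2 + if (inc k).card = 2 + 1 then 1 else 0) := by
          refine Finset.sum_le_sum fun k _ => ?_
          have := card_le_of_isClique hG (h.isClique k)
          split_ifs <;> omega
      _ = 2 * Fintype.card K + (Finset.univ.filter fun k => (inc k).card = 2 + 1).card := by
          rw [Finset.sum_add_distrib, Finset.card_filter, Finset.sum_const, Finset.card_univ,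
            smul_eq_mul, mul_comm]
  have hcount := h.mul_card_le_sum_card
  omega

end IsCliqueFamily

open Classical in
lemma two_mul_ncard_edgeSet (hG : G.IsRegularOfDegree d) :
    2 * G.edgeSet.ncard = Fintype.card V * d := by
  rw [← G.coe_edgeFinset, Set.ncard_coe_finset, ← G.sum_degrees_eq_twice_card_edges,
    Finset.sum_congr rfl fun v _ => hG v, Finset.sum_const, Finset.card_univ, smul_eq_mul]

end Counting

section Matching

variable {V : Type*} {M : SimpleGraph V} {u v : V}

lemma ncard_support_of_matching [Finite V] (hM : ∀ v a b : V, M.Adj v a → M.Adj v b → a = b) :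
    M.support.ncard = 2 * M.edgeSet.ncard := by
  classical
  have := Fintype.ofFinite V
  have hdeg : ∀ v ∈ M.support.toFinset, M.degree v = 1 := by
    intro v hv
    obtain ⟨w, hw⟩ := Set.mem_toFinset.1 hv
    exact SimpleGraph.degree_eq_one_iff_existsUnique_adj.2 ⟨w, hw, fun x hx => hM v x w hx hw⟩
  rw [← M.coe_edgeFinset, Set.ncard_coe_finset, ← M.sum_degrees_support_eq_twice_card_edges,
    Finset.sum_congr rfl hdeg, Finset.sum_const, smul_eq_mul, mul_one, Set.ncard_eq_toFinset_card']

lemma matching_sup_edge (hM : ∀ v a b : V, M.Adj v a → M.Adj v b → a = b) (hu : u ∉ M.support)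
    (hv : v ∉ M.support) (w a b : V) (ha : (M ⊔ SimpleGraph.edge u v).Adj w a)
    (hb : (M ⊔ SimpleGraph.edge u v).Adj w b) : a = b := by
  rw [SimpleGraph.sup_adj, SimpleGraph.edge_adj] at ha hb
  have hend : ∀ {x y}, M.Adj x y → x ≠ u ∧ x ≠ v := fun h =>
    ⟨fun hxu => hu (hxu ▸ ⟨_, h⟩), fun hxv => hv (hxv ▸ ⟨_, h⟩)⟩
  rcases ha with ha | ha <;> rcases hb with hb | hb
  · exact hM w a b ha hb
  · have := hend ha
    tauto
  · have := hend hb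
    tauto
  · aesop

end Matching

namespace GeometricGraph

variable {V K : Type*} {G : GeometricGraph V} {M : SimpleGraph V} {C : K → Set (ℝ × ℝ)} {u v : V}

lemma generalPosition (G : GeometricGraph V) : GeneralPosition G.pos := fun u v w huv hvw huw h =>
  G.general_position u v w huv hvw huw
    (collinear_of_orient_eq_zero (G.pos_injective.ne huv) h)

-- Otherwise `u v` could be added to the matching `M`.
lemma IsMaximalCompatibleMatching.adj_of_mem_closure (hM : G.IsMaximalCompatibleMatching M)
    (hC : IsCellDecomposition G.pos (G.graph ⊔ M) C) (huv : u ≠ v) (hu : u ∉ M.support)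
    (hv : v ∉ M.support) {k : K} (huk : G.pos u ∈ closure (C k)) (hvk : G.pos v ∈ closure (C k)) :
    G.graph.Adj u v := by
  by_contra hadj
  have hcomp : G.IsCompatibleMatching (M ⊔ SimpleGraph.edge u v) := by
    refine ⟨matching_sup_edge hM.1.matching hu hv, disjoint_sup_right.2 ⟨hM.1.disjoint, ?_⟩, ?_⟩
    · rwa [SimpleGraph.disjoint_edge]
    · rw [← sup_assoc]
      exact hM.1.noncrossing.sup_edge fun x y hxy hne =>
        hC.inter_subset G.generalPosition huv huk hvk hxy hne
  have hle := hM.2 hcomp le_sup_left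
  exact hu ⟨v, hle (Or.inr ((SimpleGraph.edge_adj _ _ _ _).2 ⟨Or.inl ⟨rfl, rfl⟩, huv⟩))⟩

open Classical in
lemma IsMaximalCompatibleMatching.isCliqueFamily [Fintype V] [Fintype K] {d : ℕ}
    (hM : G.IsMaximalCompatibleMatching M) (hC : IsCellDecomposition G.pos (G.graph ⊔ M) C)
    (hG : G.IsRegular d) (hd : d ≤ 2) :
    IsCliqueFamily G.graph d (Finset.univ.filter (· ∉ M.support)) fun k : K =>
      Finset.univ.filter fun v => v ∉ M.support ∧ G.pos v ∈ closure (C k) := by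
  refine ⟨fun k v hv => ?_, fun k u hu v hv huv => ?_, fun k l hk hkl => ?_, fun v hv => ?_⟩
  · exact Finset.mem_filter.2 ⟨Finset.mem_univ v, (Finset.mem_filter.1 hv).2.1⟩
  · have hu' := (Finset.mem_filter.1 hu).2
    have hv' := (Finset.mem_filter.1 hv).2
    exact hM.adj_of_mem_closure hC huv hu'.1 hv'.1 hu'.2 hv'.2
  · obtain ⟨x, hx, y, hy, z, hz, hxy, hxz, hyz⟩ := Finset.two_lt_card.1 hk
    have hclosure : ∀ w ∈ Finset.univ.filter fun v => v ∉ M.support ∧ G.pos v ∈ closure (C k),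
        G.pos w ∈ closure (C k) ∧ G.pos w ∈ closure (C l) := fun w hw =>
      ⟨(Finset.mem_filter.1 hw).2.2, (Finset.mem_filter.1 (hkl ▸ hw)).2.2⟩
    refine hC.eq_of_mem_closure G.generalPosition hxy hyz hxz ?_ ?_ <;>
    · simp only [insert_subset_iff, singleton_subset_iff, hclosure x hx, hclosure y hy,
        hclosure z hz, and_self]
  · have hvM : v ∉ M.support := (Finset.mem_filter.1 hv).2
    have hdeg : d ≤ min ((G.graph ⊔ M).neighborSet v).ncard 2 := by
      refine le_min ?_ hd
      rw [← hG v, ← G.graph.card_neighborSet_eq_degree, ← Nat.card_eq_fintype_card]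
      exact Set.ncard_le_ncard fun w hw => Or.inl hw
    refine (hdeg.trans_lt (hC.min_degree_lt v)).trans_eq ?_
    rw [Set.ncard_eq_toFinset_card']
    congr 1
    ext k
    simp only [mem_toFinset, mem_ofPred_eq, Finset.mem_filter, Finset.mem_univ, hvM,
      not_false_eq_true, true_and]

lemma exists_isCliqueFamily [Fintype V] (G : GeometricGraph V) {d : ℕ} (hG : G.IsRegular d)
    (hd : d ≤ 2) :
    ∃ (K : Type) (_ : Fintype K) (U : Finset V) (inc : K → Finset V),
      IsCliqueFamily G.graph d U inc ∧
      2 * Fintype.card K ≤ Fintype.card V * d + 2 * G.mm + 2 ∧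
      U.card + 2 * G.mm = Fintype.card V := by
  classical
  obtain ⟨M, hM, hMcard⟩ := G.exists_mm_eq
  obtain ⟨K, hK, C, hcard, hC⟩ := exists_isCellDecomposition G.pos_injective G.generalPosition
    hM.1.noncrossing
  have := Fintype.ofFinite K
  refine ⟨K, this, _, _, hM.isCliqueFamily hC hG hd, ?_, ?_⟩
  · have hunion : (G.graph ⊔ M).edgeSet.ncard ≤ G.graph.edgeSet.ncard + M.edgeSet.ncard := by
      rw [SimpleGraph.edgeSet_sup]
      exact Set.ncard_union_le _ _
    have hdeg := two_mul_ncard_edgeSet hG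
    rw [Nat.card_eq_fintype_card] at hcard
    omega
  · have hcover := ncard_support_of_matching hM.1.matching
    rw [hMcard, Set.ncard_eq_toFinset_card', ← Set.filter_mem_univ_eq_toFinset] at hcover
    rw [← hcover, add_comm]
    exact Finset.card_filter_add_card_filter_not (s := Finset.univ) (· ∈ M.support)

theorem two_mul_card_le [Fintype V] (G : GeometricGraph V) {d : ℕ} (hG : G.IsRegular d)
    (hd : d ≤ 2) : 2 * Fintype.card V ≤ Fintype.card V * d + 6 * G.mm + 2 := by
  obtain ⟨K, _, U, inc, hinc, hK, hU⟩ := G.exists_isCliqueFamily hG hd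
  have := hinc.card_le_card hG
  omega

theorem card_le_of_isRegular_zero [Fintype V] (G : GeometricGraph V) (hG : G.IsRegular 0) :
    Fintype.card V ≤ 3 * G.mm + 1 := by
  have := G.two_mul_card_le hG (Nat.zero_le 2)
  omega

theorem card_le_of_isRegular_one [Fintype V] (G : GeometricGraph V) (hG : G.IsRegular 1) :
    Fintype.card V ≤ 6 * G.mm + 2 := by
  have := G.two_mul_card_le hG one_le_two
  omega

theorem card_le_of_isRegular_two [Fintype V] (G : GeometricGraph V) (hG : G.IsRegular 2) :
    Fintype.card V ≤ 11 * G.mm + 3 := by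
  obtain ⟨K, _, U, inc, hinc, hK, hU⟩ := G.exists_isCliqueFamily hG le_rfl
  have := hinc.four_mul_card_le hG
  omega

end GeometricGraph

section StrictlySep

variable {E : Type*} [NormedAddCommGroup E] [NormedSpace ℝ E] {a b c d : E}

/-- The segments `a b` and `c d` are strictly separated by a hyperplane. -/
def StrictlySep (a b c d : E) : Prop :=
  ∃ f : StrongDual ℝ E, max (f a) (f b) < min (f c) (f d)

lemma StrictlySep.symm (h : StrictlySep a b c d) : StrictlySep c d a b := by
  obtain ⟨f, hf⟩ := h
  refine ⟨-f, ?_⟩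
  simpa only [neg_apply, max_neg_neg, min_neg_neg, neg_lt_neg_iff] using hf

lemma StrictlySep.disjoint (h : StrictlySep a b c d) :
    Disjoint (segment ℝ a b) (segment ℝ c d) := by
  obtain ⟨f, hf⟩ := h
  rw [disjoint_left]
  intro z hab hcd
  have hmax : f z ≤ max (f a) (f b) :=
    (f.toLinearMap.convexOn convex_univ).le_on_segment (mem_univ a) (mem_univ b) hab
  have hmin : min (f c) (f d) ≤ f z :=
    (f.toLinearMap.concaveOn convex_univ).ge_on_segment (mem_univ c) (mem_univ d) hcd
  exact (hmax.trans_lt hf).not_ge hmin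

lemma isOpen_setOf_strictlySep :
    IsOpen {w : E × E × E × E | StrictlySep w.1 w.2.1 w.2.2.1 w.2.2.2} := by
  simp only [StrictlySep, ofPred_exists]
  exact isOpen_iUnion fun f => isOpen_lt (by fun_prop) (by fun_prop)

lemma strictlySep_self_of_ne (h : a ≠ b) : StrictlySep a a b b := by
  obtain ⟨f, hf⟩ := geometric_hahn_banach_point_point h
  exact ⟨f, by simpa only [max_self, min_self] using hf⟩

lemma StrictlySep.add_smul (h : StrictlySep a b c d) (x : E) {t : ℝ} (ht : 0 < t) :
    StrictlySep (x + t • a) (x + t • b) (x + t • c) (x + t • d) := by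
  obtain ⟨f, hf⟩ := h
  refine ⟨f, ?_⟩
  simp only [max_lt_iff, lt_min_iff] at hf
  simpa only [map_add, map_smul, smul_eq_mul, max_lt_iff, lt_min_iff, add_lt_add_iff_left,
    mul_lt_mul_iff_right₀ ht] using hf

end StrictlySep

section Orient

variable {R S : Type*} [CommRing R] [CommRing S]

lemma orient_map (f : R →+* S) (a b c : R × R) :
    orient (Prod.map f f a) (Prod.map f f b) (Prod.map f f c) = f (orient a b c) := by
  simp only [orient, Prod.map_fst, Prod.map_snd, map_sub, map_mul]

lemma orient_add_smul (x a b c : R × R) (t : R) :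
    orient (x + t • a) (x + t • b) (x + t • c) = t ^ 2 * orient a b c := by
  simp only [orient, Prod.fst_add, Prod.snd_add, Prod.smul_fst, Prod.smul_snd, smul_eq_mul]
  ring

variable [LinearOrder R] [LinearOrder S] {a b c d : R × R}

instance : Decidable (Crosses a b c d) := inferInstanceAs (Decidable (_ ∧ _))

lemma Crosses.map [IsOrderedRing S] (h : Crosses a b c d) {f : R →+* S} (hf : StrictMono f) :
    Crosses (Prod.map f f a) (Prod.map f f b) (Prod.map f f c) (Prod.map f f d) := by
  simpa only [Crosses, orient_map, ← map_mul, ← map_zero f, hf.lt_iff_lt] using h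

lemma Crosses.add_smul [IsStrictOrderedRing R] (h : Crosses a b c d) (x : R × R) {t : R}
    (ht : 0 < t) : Crosses (x + t • a) (x + t • b) (x + t • c) (x + t • d) := by
  have ht2 : 0 < t ^ 2 * t ^ 2 := by positivity
  have hscale : ∀ {y z : R}, y * z < 0 → t ^ 2 * y * (t ^ 2 * z) < 0 := fun hyz => by
    rw [mul_mul_mul_comm]
    exact mul_neg_of_pos_of_neg ht2 hyz
  simp only [Crosses, orient_add_smul]
  exact ⟨hscale h.1, hscale h.2⟩

lemma Crosses.ne (h : Crosses a b c d) : a ≠ b := by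
  rintro rfl
  simp [Crosses, orient] at h

end Orient

lemma strictlySep_of_orient_mul_pos {a b c d : ℝ × ℝ} (h : 0 < orient a b c * orient a b d) :
    StrictlySep a b c d := by
  let f : StrongDual ℝ (ℝ × ℝ) := (b.1 - a.1) • ContinuousLinearMap.snd ℝ ℝ ℝ -
    (b.2 - a.2) • ContinuousLinearMap.fst ℝ ℝ ℝ
  have hf : ∀ z : ℝ × ℝ, f z = f a + orient a b z := fun z => by
    simp only [f, orient, sub_apply, smul_apply, ContinuousLinearMap.coe_fst',
      ContinuousLinearMap.coe_snd', smul_eq_mul]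
    ring
  have hfb : f b = f a := by rw [hf b, orient_self_right, add_zero]
  rcases pos_and_pos_or_neg_and_neg_of_mul_pos h with ⟨hc, hd⟩ | ⟨hc, hd⟩
  · refine ⟨f, ?_⟩
    rw [hfb, hf c, hf d, max_self, lt_min_iff]
    exact ⟨lt_add_of_pos_right _ hc, lt_add_of_pos_right _ hd⟩
  · refine StrictlySep.symm ⟨f, ?_⟩
    rw [hfb, hf c, hf d, min_self, max_lt_iff]
    exact ⟨add_lt_of_neg_right _ hc, add_lt_of_neg_right _ hd⟩

section GeneralPosition

variable {V : Type*}

lemma eventually_quadratic_ne_zero {A B C : ℝ} (h : B ≠ 0 ∨ C ≠ 0) :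
    ∀ᶠ t in 𝓝[≠] (0 : ℝ), A + B * t + C * t ^ 2 ≠ 0 := by
  let P : Polynomial ℝ := .C A + .C B * .X + .C C * .X ^ 2
  have hP : P ≠ 0 := by
    rintro hzero
    have hB : B = 0 := by simpa [P] using congrArg (Polynomial.coeff · 1) hzero
    have hC : C = 0 := by simpa [P] using congrArg (Polynomial.coeff · 2) hzero
    exact h.elim (· hB) (· hC)
  have hroots : ∀ᶠ t in 𝓝[≠] (0 : ℝ), ¬ P.IsRoot t := by
    have hcodiscrete := (Polynomial.finite_setOfPred_isRoot hP).compl_mem_codiscrete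
    have hmem := disjoint_principal_right.1 (mem_codiscrete.1 hcodiscrete 0)
    rwa [compl_compl] at hmem
  simpa [P, Polynomial.IsRoot] using hroots

-- Three points moving along the parabola `(s, s ^ 2)` contribute a Vandermonde determinant to the
-- leading coefficient of the orientation.
lemma eventually_orient_ne_zero (a b c : ℝ × ℝ) {r s t : ℝ} (hrs : r ≠ s) (hst : s ≠ t)
    (hrt : r ≠ t) :
    ∀ᶠ ε in 𝓝[≠] (0 : ℝ),
      orient (a + ε • (r, r ^ 2)) (b + ε • (s, s ^ 2)) (c + ε • (t, t ^ 2)) ≠ 0 := by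
  have hvandermonde : (s - r) * (t - r) * (t - s) ≠ 0 :=
    mul_ne_zero (mul_ne_zero (sub_ne_zero.2 hrs.symm) (sub_ne_zero.2 hrt.symm))
      (sub_ne_zero.2 hst.symm)
  filter_upwards [eventually_quadratic_ne_zero (A := orient a b c)
    (B := (b.1 - a.1) * (t ^ 2 - r ^ 2) + (s - r) * (c.2 - a.2) - (b.2 - a.2) * (t - r) -
      (s ^ 2 - r ^ 2) * (c.1 - a.1)) (Or.inr hvandermonde)] with ε hε
  convert hε using 1
  simp only [orient, Prod.fst_add, Prod.snd_add, Prod.smul_fst, Prod.smul_snd, smul_eq_mul]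
  ring

lemma eventually_add_smul_ne (a b : ℝ × ℝ) {r s : ℝ} (hrs : r ≠ s) :
    ∀ᶠ ε in 𝓝[≠] (0 : ℝ), a + ε • (r, r ^ 2) ≠ b + ε • (s, s ^ 2) := by
  filter_upwards [eventually_quadratic_ne_zero (A := a.1 - b.1) (B := r - s) (C := 0)
    (Or.inl (sub_ne_zero.2 hrs))] with ε hε heq
  apply hε
  have hfst := congrArg Prod.fst heq
  simp only [Prod.fst_add, Prod.smul_fst, smul_eq_mul] at hfst
  linear_combination hfst

lemma dense_setOf_injective_and_generalPosition [Finite V] :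
    Dense {p : V → ℝ × ℝ | p.Injective ∧ GeneralPosition p} := by
  intro p
  obtain ⟨f, hf⟩ : ∃ f : V → ℝ, f.Injective :=
    ⟨_, Nat.cast_injective.comp (Fin.val_injective.comp (Finite.equivFin V).injective)⟩
  let q : ℝ → V → ℝ × ℝ := fun ε v => p v + ε • (f v, f v ^ 2)
  have hq : Tendsto q (𝓝[≠] 0) (𝓝 p) := by
    have hcont : Continuous q := by fun_prop
    have hzero : q 0 = p := by simp only [q, zero_smul, add_zero]
    exact hzero ▸ (hcont.tendsto 0).mono_left nhdsWithin_le_nhds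
  refine mem_closure_of_tendsto hq (Eventually.and ?_ ?_)
  · simp only [Function.Injective, ← not_imp_not (a := _ = _), eventually_all]
    exact fun u v huv => eventually_add_smul_ne _ _ (hf.ne huv)
  · simp only [GeneralPosition, eventually_all]
    exact fun u v w huv hvw huw =>
      eventually_orient_ne_zero _ _ _ (hf.ne huv) (hf.ne hvw) (hf.ne huw)

end GeneralPosition

section MatchedGraph

variable {V W S : Type*} {G M : SimpleGraph V} {G₀ M₀ : SimpleGraph W} {d m m₀ : ℕ}

/-- A `d`-regular graph `G` together with a matching `M` of `m` edges, none of which belongs to `G`;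
the size of `M` is recorded through its support. -/
structure IsMatchedGraph (G M : SimpleGraph V) (d m : ℕ) : Prop where
  regular : ∀ v, (G.neighborSet v).ncard = d
  matching : ∀ v a b : V, M.Adj v a → M.Adj v b → a = b
  disjoint : Disjoint G M
  support : M.support.ncard = 2 * m

lemma disjoint_iff_forall_adj : Disjoint G M ↔ ∀ u v, G.Adj u v → ¬ M.Adj u v := by
  rw [disjoint_iff_inf_le]
  exact ⟨fun h u v hG hM => h ⟨hG, hM⟩, fun h u v huv => h u v huv.1 huv.2⟩

lemma ncard_preimage_equiv (e : W ≃ V) (s : Set V) : (e ⁻¹' s).ncard = s.ncard := by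
  rw [← Equiv.image_symm_eq_preimage, ncard_image_of_injective s e.symm.injective]

lemma support_comap_equiv (e : W ≃ V) (M : SimpleGraph V) :
    (M.comap e).support = e ⁻¹' M.support := by
  ext w
  exact e.exists_congr fun v => Iff.rfl

lemma IsMatchedGraph.comap_equiv (h : IsMatchedGraph G M d m) (e : W ≃ V) :
    IsMatchedGraph (G.comap e) (M.comap e) d m where
  regular w := (ncard_preimage_equiv e _).trans (h.regular (e w))
  matching v a b ha hb := e.injective (h.matching _ _ _ ha hb)
  disjoint := disjoint_iff_forall_adj.2 fun u v => disjoint_iff_forall_adj.1 h.disjoint (e u) (e v)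
  support := by rw [support_comap_equiv, ncard_preimage_equiv, h.support]

lemma neighborSet_sum_inl (w : W) :
    (G₀ ⊕g G).neighborSet (Sum.inl w) = Sum.inl '' G₀.neighborSet w := by
  ext (u | v) <;> simp

lemma neighborSet_sum_inr (v : V) :
    (G₀ ⊕g G).neighborSet (Sum.inr v) = Sum.inr '' G.neighborSet v := by
  ext (u | v) <;> simp

lemma support_sum : (G₀ ⊕g G).support = Sum.inl '' G₀.support ∪ Sum.inr '' G.support := by
  ext (u | v) <;> simp [SimpleGraph.mem_support]

lemma sup_sum : (G₀ ⊕g G) ⊔ (M₀ ⊕g M) = (G₀ ⊔ M₀) ⊕g (G ⊔ M) := by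
  ext (u | u) (v | v) <;> simp

lemma bot_boxProd_adj {x y : S × V} :
    ((⊥ : SimpleGraph S) □ G).Adj x y ↔ x.1 = y.1 ∧ G.Adj x.2 y.2 := by
  simp [and_comm]

lemma neighborSet_bot_boxProd (s : S) (v : V) :
    ((⊥ : SimpleGraph S) □ G).neighborSet (s, v) = {s} ×ˢ G.neighborSet v := by
  simp [SimpleGraph.neighborSet_boxProd]

lemma support_bot_boxProd : ((⊥ : SimpleGraph S) □ G).support = univ ×ˢ G.support := by
  ext ⟨s, v⟩
  simp [SimpleGraph.mem_support]

lemma sup_bot_boxProd :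
    ((⊥ : SimpleGraph S) □ G) ⊔ ((⊥ : SimpleGraph S) □ M) = (⊥ : SimpleGraph S) □ (G ⊔ M) := by
  ext x y
  simp only [SimpleGraph.sup_adj, bot_boxProd_adj, and_or_left]

lemma IsMatchedGraph.sum [Finite W] [Finite V] (h₀ : IsMatchedGraph G₀ M₀ d m₀)
    (h : IsMatchedGraph G M d m) : IsMatchedGraph (G₀ ⊕g G) (M₀ ⊕g M) d (m₀ + m) where
  regular := by
    rintro (w | v)
    · rw [neighborSet_sum_inl, ncard_image_of_injective _ Sum.inl_injective, h₀.regular]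
    · rw [neighborSet_sum_inr, ncard_image_of_injective _ Sum.inr_injective, h.regular]
  matching := by
    have := h₀.matching
    have := h.matching
    rintro (w | v) (a | a) (b | b) <;> simp only [SimpleGraph.sum_adj] <;> grind
  disjoint := by
    have := disjoint_iff_forall_adj.1 h₀.disjoint
    have := disjoint_iff_forall_adj.1 h.disjoint
    rw [disjoint_iff_forall_adj]
    rintro (u | u) (v | v) <;> simp only [SimpleGraph.sum_adj] <;> grind
  support := by
    have hdisj : Disjoint (Sum.inl '' M₀.support) (Sum.inr '' M.support) :=
      isCompl_range_inl_range_inr.disjoint.mono (image_subset_range _ _) (image_subset_range _ _)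
    rw [support_sum, ncard_union_eq hdisj,
      ncard_image_of_injective _ Sum.inl_injective, ncard_image_of_injective _ Sum.inr_injective,
      h₀.support, h.support, mul_add]

lemma IsMatchedGraph.bot_boxProd (S : Type*) (h : IsMatchedGraph G M d m) :
    IsMatchedGraph ((⊥ : SimpleGraph S) □ G) (⊥ □ M) d (Nat.card S * m) where
  regular := by
    rintro ⟨s, v⟩
    rw [neighborSet_bot_boxProd, ncard_prod, ncard_singleton, h.regular, one_mul]
  matching x a b ha hb := by
    rw [bot_boxProd_adj] at ha hb
    exact Prod.ext (ha.1.symm.trans hb.1) (h.matching _ _ _ ha.2 hb.2)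
  disjoint := by
    simp only [disjoint_iff_forall_adj, bot_boxProd_adj]
    exact fun x y hG hM => disjoint_iff_forall_adj.1 h.disjoint _ _ hG.2 hM.2
  support := by
    rw [support_bot_boxProd, ncard_prod, ncard_univ, h.support]
    ring

lemma isMatchedGraph_top (d : ℕ) :
    IsMatchedGraph (⊤ : SimpleGraph (Fin (d + 1))) ⊥ d 0 where
  regular v := by
    rw [SimpleGraph.neighborSet_top, ncard_compl, ncard_singleton, Nat.card_eq_fintype_card,
      Fintype.card_fin, Nat.add_sub_cancel]
  matching _ _ _ h := h.elim
  disjoint := disjoint_bot_right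
  support := by rw [SimpleGraph.support_bot, ncard_empty]

end MatchedGraph

section BlockedDrawing

variable {V : Type*} {p : V → ℝ × ℝ} {G H M : SimpleGraph V} {a b : ℝ × ℝ} {d m : ℕ}

/-- Any two edges of `H` without a common end vertex are drawn strictly separated. Unlike being
noncrossing, this is an open condition on the drawing, which may have coinciding vertices. -/
def IsSeparated (p : V → ℝ × ℝ) (H : SimpleGraph V) : Prop :=
  ∀ u v x y, H.Adj u v → H.Adj x y → u ≠ x → u ≠ y → v ≠ x → v ≠ y →
    StrictlySep (p u) (p v) (p x) (p y)

/-- Some edge of the drawing of `H` properly crosses the segment `a b`. -/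
def Blocks (p : V → ℝ × ℝ) (H : SimpleGraph V) (a b : ℝ × ℝ) : Prop :=
  ∃ x y, H.Adj x y ∧ Crosses a b (p x) (p y)

lemma isOpen_setOf_isSeparated [Finite V] (H : SimpleGraph V) :
    IsOpen {p : V → ℝ × ℝ | IsSeparated p H} := by
  simp only [IsSeparated, ofPred_forall]
  refine isOpen_iInter_of_finite fun u => isOpen_iInter_of_finite fun v =>
    isOpen_iInter_of_finite fun x => isOpen_iInter_of_finite fun y =>
    isOpen_iInter_of_finite fun _ => isOpen_iInter_of_finite fun _ =>
    isOpen_iInter_of_finite fun _ => isOpen_iInter_of_finite fun _ =>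
    isOpen_iInter_of_finite fun _ => isOpen_iInter_of_finite fun _ => ?_
  have hcont : Continuous fun p : V → ℝ × ℝ => (p u, p v, p x, p y) := by fun_prop
  exact isOpen_setOf_strictlySep.preimage hcont

lemma isOpen_setOf_blocks (H : SimpleGraph V) :
    IsOpen {w : (V → ℝ × ℝ) × (ℝ × ℝ) × (ℝ × ℝ) | Blocks w.1 H w.2.1 w.2.2} := by
  simp only [Blocks, ofPred_exists]
  refine isOpen_iUnion fun x => isOpen_iUnion fun y => isOpen_const.and ?_
  have hcont : Continuous fun w : (V → ℝ × ℝ) × (ℝ × ℝ) × (ℝ × ℝ) =>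
    (w.2.1, w.2.2, w.1 x, w.1 y) := by fun_prop
  exact isOpen_setOf_crosses.preimage hcont

/-- A drawing of `G` and the matching `M`, not necessarily in general position, that certifies in a
way stable under perturbation that `M` is compatible with `G` and cannot be enlarged. -/
structure IsBlockedDrawing (p : V → ℝ × ℝ) (G M : SimpleGraph V) : Prop where
  sep : IsSeparated p (G ⊔ M)
  blocked : ∀ u v, u ≠ v → u ∉ M.support → v ∉ M.support → ¬ G.Adj u v →
    Blocks p (G ⊔ M) (p u) (p v)

lemma isOpen_setOf_isBlockedDrawing [Finite V] (G M : SimpleGraph V) :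
    IsOpen {p : V → ℝ × ℝ | IsBlockedDrawing p G M} := by
  refine isOpen_iff_eventually.2 fun p hp => ?_
  have hblocked : ∀ᶠ q in 𝓝 p, ∀ u v, u ≠ v → u ∉ M.support → v ∉ M.support → ¬ G.Adj u v →
      Blocks q (G ⊔ M) (q u) (q v) := by
    simp only [eventually_all]
    intro u v huv hu hv hadj
    have hcont : Continuous fun q : V → ℝ × ℝ => (q, q u, q v) := by fun_prop
    exact ((isOpen_setOf_blocks (G ⊔ M)).preimage hcont).mem_nhds (hp.blocked u v huv hu hv hadj)
  filter_upwards [(isOpen_setOf_isSeparated (G ⊔ M)).mem_nhds hp.sep, hblocked]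
    with q hsep hblocked using ⟨hsep, hblocked⟩

lemma IsSeparated.isNoncrossing (h : IsSeparated p H) (hp : GeneralPosition p) :
    IsNoncrossing p H := by
  intro u v x y huv hxy hne
  by_cases hcom : u = x ∨ u = y ∨ v = x ∨ v = y
  · exact hp.inter_subset_of_common_endpoint huv.ne hxy.ne hne hcom
  · push Not at hcom
    obtain ⟨hux, huy, hvx, hvy⟩ := hcom
    exact ((h u v x y huv hxy hux huy hvx hvy).disjoint.inter_eq).trans_subset (empty_subset _)

lemma IsNoncrossing.not_blocks (hH : IsNoncrossing p H) {u v : V} (huv : H.Adj u v) :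
    ¬ Blocks p H (p u) (p v) := by
  rintro ⟨x, y, hxy, hcross⟩
  have hdisj : ∀ w, w = u ∨ w = v → ¬ (w = x ∨ w = y) := by
    rintro w hw hw'
    have := hcross.1
    have := hcross.2
    rcases hw with rfl | rfl <;> rcases hw' with rfl | rfl <;>
      simp_all [orient_self_right, orient_self_outer]
  have hne : s(u, v) ≠ s(x, y) := fun heq =>
    hdisj u (.inl rfl) (Sym2.mem_iff.1 (heq ▸ Sym2.mem_mk_left u v))
  obtain ⟨z, hz, hz'⟩ := hcross.exists_mem_openSegment
  obtain ⟨w, ⟨hw, hw'⟩, -⟩ := hH u v x y huv hxy hne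
    ⟨openSegment_subset_segment ℝ _ _ hz, openSegment_subset_segment ℝ _ _ hz'⟩
  exact hdisj w hw hw'

lemma IsNoncrossing.mono {H' : SimpleGraph V} (hH : IsNoncrossing p H) (hle : H' ≤ H) :
    IsNoncrossing p H' :=
  fun u v x y huv hxy => hH u v x y (hle huv) (hle hxy)

lemma Blocks.mono {H' : SimpleGraph V} (h : Blocks p H a b) (hle : H ≤ H') : Blocks p H' a b := by
  obtain ⟨x, y, hxy, hcross⟩ := h
  exact ⟨x, y, hle hxy, hcross⟩

lemma GeometricGraph.isMaximalCompatibleMatching_of_isBlockedDrawing (Γ : GeometricGraph V)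
    (hM : IsMatchedGraph Γ.graph M d m) (h : IsBlockedDrawing Γ.pos Γ.graph M) :
    Γ.IsMaximalCompatibleMatching M := by
  refine ⟨⟨hM.matching, hM.disjoint, h.sep.isNoncrossing Γ.generalPosition⟩,
    fun M' hM' hle u v huv => ?_⟩
  by_contra hMuv
  have hu : u ∉ M.support := by
    rintro ⟨x, hx⟩
    exact hMuv (hM'.matching u x v (hle hx) huv ▸ hx)
  have hv : v ∉ M.support := by
    rintro ⟨x, hx⟩
    exact hMuv (hM'.matching v x u (hle hx) huv.symm ▸ hx).symm
  have hadj : ¬ Γ.graph.Adj u v := fun hG =>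
    disjoint_iff_forall_adj.1 hM'.disjoint u v hG huv
  exact hM'.noncrossing.not_blocks (Or.inr huv)
    ((h.blocked u v huv.ne hu hv hadj).mono (sup_le_sup_left hle _))

lemma IsBlockedDrawing.exists_geometricGraph [Fintype V] (h : IsBlockedDrawing p G M)
    (hM : IsMatchedGraph G M d m) : ∃ Γ : GeometricGraph V, Γ.IsRegular d ∧ Γ.mm ≤ m := by
  obtain ⟨q, hq, hinj, hgp⟩ := dense_setOf_injective_and_generalPosition.inter_open_nonempty _
    (isOpen_setOf_isBlockedDrawing G M) ⟨p, h⟩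
  let Γ : GeometricGraph V :=
    { pos := q
      graph := G
      pos_injective := hinj
      general_position := fun u v w huv hvw huw hcol =>
        hgp u v w huv hvw huw (orient_eq_zero_of_collinear hcol)
      noncrossing := (hq.sep.isNoncrossing hgp).mono le_sup_left }
  refine ⟨Γ, fun v => ?_, Nat.sInf_le ⟨M, ?_, ?_⟩⟩
  · classical
    rw [← hM.regular v, ← SimpleGraph.card_neighborSet_eq_degree, ← Nat.card_eq_fintype_card,
      Nat.card_coe_set_eq]
  · exact Γ.isMaximalCompatibleMatching_of_isBlockedDrawing hM hq
  · have hsupport := ncard_support_of_matching hM.matching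
    have := hM.support
    omega

lemma IsBlockedDrawing.comap_equiv {W : Type*} (h : IsBlockedDrawing p G M) (e : W ≃ V) :
    IsBlockedDrawing (p ∘ e) (G.comap e) (M.comap e) where
  sep u v x y huv hxy hux huy hvx hvy := h.sep _ _ _ _ huv hxy (e.injective.ne hux)
    (e.injective.ne huy) (e.injective.ne hvx) (e.injective.ne hvy)
  blocked u v huv hu hv hadj := by
    rw [support_comap_equiv] at hu hv
    obtain ⟨x, y, hxy, hcross⟩ := h.blocked (e u) (e v) (e.injective.ne huv) hu hv hadj
    refine ⟨e.symm x, e.symm y, ?_, ?_⟩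
    · simpa using hxy
    · simpa using hcross

end BlockedDrawing

section Skeleton

variable {V W S : Type*} {r : W → ℝ × ℝ} {q : S → ℝ × ℝ} {p : V → ℝ × ℝ}
  {G H M : SimpleGraph V} {G₀ H₀ M₀ : SimpleGraph W} {d m n : ℕ}

lemma IsSeparated.sum_elim (hr : IsSeparated r H₀) (hp : IsSeparated p H)
    (h : ∀ u v x y, H₀.Adj u v → H.Adj x y → StrictlySep (r u) (r v) (p x) (p y)) :
    IsSeparated (Sum.elim r p) (H₀ ⊕g H) := by
  rintro (u | u) (v | v) (x | x) (y | y) huv hxy hux huy hvx hvy <;>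
    simp only [SimpleGraph.sum_adj] at huv hxy
  · exact hr u v x y huv hxy (hux <| congrArg _ ·) (huy <| congrArg _ ·) (hvx <| congrArg _ ·)
      (hvy <| congrArg _ ·)
  · exact h u v x y huv hxy
  · exact (h x y u v hxy huv).symm
  · exact hp u v x y huv hxy (hux <| congrArg _ ·) (huy <| congrArg _ ·) (hvx <| congrArg _ ·)
      (hvy <| congrArg _ ·)

lemma isSeparated_bot_boxProd {P : S × V → ℝ × ℝ} (h : ∀ s, IsSeparated (fun v => P (s, v)) H)
    (h' : ∀ s t, s ≠ t → ∀ u v x y, StrictlySep (P (s, u)) (P (s, v)) (P (t, x)) (P (t, y))) :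
    IsSeparated P (⊥ □ H) := by
  rintro ⟨s, u⟩ ⟨s', v⟩ ⟨t, x⟩ ⟨t', y⟩ huv hxy hux huy hvx hvy
  obtain ⟨rfl : s = s', huv⟩ := bot_boxProd_adj.1 huv
  obtain ⟨rfl : t = t', hxy⟩ := bot_boxProd_adj.1 hxy
  by_cases hst : s = t
  · subst hst
    exact h s u v x y huv hxy (hux <| congrArg _ ·) (huy <| congrArg _ ·) (hvx <| congrArg _ ·)
      (hvy <| congrArg _ ·)
  · exact h' s t hst u v x y

/-- A drawing of a graph together with a perfect matching, and points `q s` off its edges, called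
slots, any two of which are blocked from each other. Small copies of a further drawing can be
inserted at the slots without creating new compatible edges between different copies. -/
structure IsSkeleton (r : W → ℝ × ℝ) (q : S → ℝ × ℝ) (G M : SimpleGraph W) : Prop where
  perfect : M.support = univ
  sep : IsSeparated r (G ⊔ M)
  slot_sep : ∀ s x y, (G ⊔ M).Adj x y → StrictlySep (r x) (r y) (q s) (q s)
  blocked : ∀ s t, s ≠ t → Blocks r (G ⊔ M) (q s) (q t)

lemma tendsto_add_smul_nhdsGT_zero (x y : ℝ × ℝ) :
    Tendsto (fun t : ℝ => x + t • y) (𝓝[>] 0) (𝓝 x) := by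
  have hcont : Continuous fun t : ℝ => x + t • y := by fun_prop
  simpa only [zero_smul, add_zero] using (hcont.tendsto 0).mono_left nhdsWithin_le_nhds

lemma StrictlySep.eventually_add_smul {a b c d : ℝ × ℝ} (h : StrictlySep a b c d)
    (u v x y : ℝ × ℝ) :
    ∀ᶠ t in 𝓝[>] (0 : ℝ), StrictlySep (a + t • u) (b + t • v) (c + t • x) (d + t • y) :=
  ((tendsto_add_smul_nhdsGT_zero a u).prodMk_nhds <|
    (tendsto_add_smul_nhdsGT_zero b v).prodMk_nhds <|
    (tendsto_add_smul_nhdsGT_zero c x).prodMk_nhds <|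
    tendsto_add_smul_nhdsGT_zero d y).eventually (isOpen_setOf_strictlySep.mem_nhds h)

lemma Blocks.eventually_add_smul {a b : ℝ × ℝ} (h : Blocks r H₀ a b) (u v : ℝ × ℝ) :
    ∀ᶠ t in 𝓝[>] (0 : ℝ), Blocks r H₀ (a + t • u) (b + t • v) :=
  (tendsto_const_nhds.prodMk_nhds <| (tendsto_add_smul_nhdsGT_zero a u).prodMk_nhds <|
    tendsto_add_smul_nhdsGT_zero b v).eventually ((isOpen_setOf_blocks H₀).mem_nhds h)

lemma IsBlockedDrawing.add_smul (h : IsBlockedDrawing p G M) (x : ℝ × ℝ) {t : ℝ} (ht : 0 < t) :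
    IsBlockedDrawing (fun v => x + t • p v) G M where
  sep u v y z huv hyz huy huz hvy hvz := (h.sep u v y z huv hyz huy huz hvy hvz).add_smul x ht
  blocked u v huv hu hv hadj := by
    obtain ⟨y, z, hyz, hcross⟩ := h.blocked u v huv hu hv hadj
    exact ⟨y, z, hyz, hcross.add_smul x ht⟩

lemma Blocks.sum_elim_left {a b : ℝ × ℝ} (h : Blocks r H₀ a b) :
    Blocks (Sum.elim r p) (H₀ ⊕g H) a b := by
  obtain ⟨x, y, hxy, hcross⟩ := h
  exact ⟨.inl x, .inl y, hxy, hcross⟩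

lemma Blocks.sum_elim_right {a b : ℝ × ℝ} (h : Blocks p H a b) :
    Blocks (Sum.elim r p) (H₀ ⊕g H) a b := by
  obtain ⟨x, y, hxy, hcross⟩ := h
  exact ⟨.inr x, .inr y, hxy, hcross⟩

lemma Blocks.bot_boxProd {P : S × V → ℝ × ℝ} {a b : ℝ × ℝ} (s : S)
    (h : Blocks (fun v => P (s, v)) H a b) : Blocks P (⊥ □ H) a b := by
  obtain ⟨x, y, hxy, hcross⟩ := h
  exact ⟨(s, x), (s, y), bot_boxProd_adj.2 ⟨rfl, hxy⟩, hcross⟩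

lemma IsSkeleton.isBlockedDrawing_sum (h₀ : IsSkeleton r q G₀ M₀) {P : S × V → ℝ × ℝ}
    (hP : ∀ s, IsBlockedDrawing (fun v => P (s, v)) G M)
    (hskeleton : ∀ x y s u v, (G₀ ⊔ M₀).Adj x y →
      StrictlySep (r x) (r y) (P (s, u)) (P (s, v)))
    (hslots : ∀ s s', s ≠ s' → ∀ u v x y,
      StrictlySep (P (s, u)) (P (s, v)) (P (s', x)) (P (s', y)))
    (hblocked : ∀ s s', s ≠ s' → ∀ u v, Blocks r (G₀ ⊔ M₀) (P (s, u)) (P (s', v))) :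
    IsBlockedDrawing (Sum.elim r P) (G₀ ⊕g ⊥ □ G) (M₀ ⊕g ⊥ □ M) where
  sep := by
    rw [sup_sum, sup_bot_boxProd]
    refine h₀.sep.sum_elim (isSeparated_bot_boxProd (fun s => (hP s).sep) hslots) ?_
    rintro x y ⟨s, u⟩ ⟨s', v⟩ hxy huv
    obtain ⟨rfl : s = s', -⟩ := bot_boxProd_adj.1 huv
    exact hskeleton x y s u v hxy
  blocked := by
    rw [sup_sum, sup_bot_boxProd, support_sum, h₀.perfect, support_bot_boxProd]
    rintro (w | ⟨s, u⟩) (w' | ⟨s', v⟩) huv hu hv hadj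
    · exact absurd (.inl (mem_image_of_mem _ (mem_univ w))) hu
    · exact absurd (.inl (mem_image_of_mem _ (mem_univ w))) hu
    · exact absurd (.inl (mem_image_of_mem _ (mem_univ w'))) hv
    · by_cases hs : s = s'
      · subst hs
        simp only [SimpleGraph.sum_adj, bot_boxProd_adj, true_and] at hadj
        exact (((hP s).blocked u v (huv <| by rw [·])
          (fun hmem => hu (.inr (mem_image_of_mem _ ⟨mem_univ s, hmem⟩)))
          (fun hmem => hv (.inr (mem_image_of_mem _ ⟨mem_univ s, hmem⟩))) hadj).bot_boxProd
            s).sum_elim_right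
      · exact (hblocked s s' hs u v).sum_elim_left

lemma IsSkeleton.exists_isBlockedDrawing_sum [Finite W] [Finite S] [Finite V]
    (h₀ : IsSkeleton r q G₀ M₀) (h : IsBlockedDrawing p G M) :
    ∃ P : W ⊕ S × V → ℝ × ℝ, IsBlockedDrawing P (G₀ ⊕g ⊥ □ G) (M₀ ⊕g ⊥ □ M) := by
  have hskeleton : ∀ᶠ t in 𝓝[>] (0 : ℝ), ∀ x y s u v, (G₀ ⊔ M₀).Adj x y →
      StrictlySep (r x) (r y) (q s + t • p u) (q s + t • p v) := by
    simp only [eventually_all]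
    intro x y s u v hxy
    simpa only [smul_zero, add_zero] using
      (h₀.slot_sep s x y hxy).eventually_add_smul 0 0 (p u) (p v)
  have hslots : ∀ᶠ t in 𝓝[>] (0 : ℝ), ∀ s s', s ≠ s' → ∀ u v x y,
      StrictlySep (q s + t • p u) (q s + t • p v) (q s' + t • p x) (q s' + t • p y) := by
    simp only [eventually_all]
    intro s s' hs u v x y
    obtain ⟨_, _, -, hcross⟩ := h₀.blocked s s' hs
    exact (strictlySep_self_of_ne hcross.ne).eventually_add_smul _ _ _ _
  have hblocked : ∀ᶠ t in 𝓝[>] (0 : ℝ), ∀ s s', s ≠ s' → ∀ u v,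
      Blocks r (G₀ ⊔ M₀) (q s + t • p u) (q s' + t • p v) := by
    simp only [eventually_all]
    exact fun s s' hs u v => (h₀.blocked s s' hs).eventually_add_smul _ _
  obtain ⟨t, hskeleton, hslots, hblocked, ht⟩ :=
    (hskeleton.and (hslots.and (hblocked.and self_mem_nhdsWithin))).exists
  exact ⟨_, h₀.isBlockedDrawing_sum (P := fun x => q x.1 + t • p x.2)
    (fun s => h.add_smul (q s) ht) hskeleton hslots hblocked⟩

end Skeleton

section LineSeparated

variable {V : Type*} {r : V → ℤ × ℤ} {H : SimpleGraph V}

/-- Of any two edges of `H` without a common end vertex, one lies strictly on one side of the line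
through the other. This is strict separation in a form that can be decided over the integers. -/
def IsLineSeparated (r : V → ℤ × ℤ) (H : SimpleGraph V) : Prop :=
  ∀ u v, H.Adj u v → ∀ x y, H.Adj x y → u ≠ x → u ≠ y → v ≠ x → v ≠ y →
    0 < orient (r u) (r v) (r x) * orient (r u) (r v) (r y) ∨
      0 < orient (r x) (r y) (r u) * orient (r x) (r y) (r v)

instance [Fintype V] [DecidableEq V] [DecidableRel H.Adj] : Decidable (IsLineSeparated r H) :=
  inferInstanceAs (Decidable (∀ _, _))

lemma IsLineSeparated.isSeparated (h : IsLineSeparated r H) :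
    IsSeparated (Prod.map (Int.castRingHom ℝ) (Int.castRingHom ℝ) ∘ r) H := by
  let p : V → ℝ × ℝ := Prod.map (Int.castRingHom ℝ) (Int.castRingHom ℝ) ∘ r
  have hcast : ∀ {u v x y : V}, 0 < orient (r u) (r v) (r x) * orient (r u) (r v) (r y) →
      StrictlySep (p u) (p v) (p x) (p y) := fun hpos => by
    refine strictlySep_of_orient_mul_pos ?_
    simp only [p, Function.comp_apply, orient_map, ← map_mul]
    exact Int.cast_pos.2 hpos
  intro u v x y huv hxy hux huy hvx hvy
  exact (h u v huv x y hxy hux huy hvx hvy).elim hcast fun hpos => (hcast hpos).symm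

end LineSeparated

section Tightness

variable {V S : Type*} {p : V → ℝ × ℝ} {G M : SimpleGraph V} {c d l m m₀ n : ℕ}

lemma isMatchedGraph_of_degree_eq [Fintype V] [DecidableRel G.Adj]
    (hreg : ∀ v, G.degree v = d) (hmatching : ∀ v a b, M.Adj v a → M.Adj v b → a = b)
    (hdisj : Disjoint G M) (hperf : M.support = univ) (hcard : Fintype.card V = 2 * m) :
    IsMatchedGraph G M d m where
  regular v := by
    rw [← Nat.card_coe_set_eq, Nat.card_eq_fintype_card, SimpleGraph.card_neighborSet_eq_degree,
      hreg v]
  matching := hmatching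
  disjoint := hdisj
  support := by rw [hperf, ncard_univ, Nat.card_eq_fintype_card, hcard]

lemma isSkeleton_of_int {r : V → ℤ × ℤ} {q : S → ℤ × ℤ} (hperf : M.support = univ)
    (hsep : IsLineSeparated r (G ⊔ M))
    (hslot : ∀ x y, (G ⊔ M).Adj x y → ∀ s, orient (r x) (r y) (q s) ≠ 0)
    (hblocked : ∀ s t, s ≠ t →
      ∃ x y, (G ⊔ M).Adj x y ∧ Crosses (q s) (q t) (r x) (r y)) :
    IsSkeleton (Prod.map (Int.castRingHom ℝ) (Int.castRingHom ℝ) ∘ r)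
      (Prod.map (Int.castRingHom ℝ) (Int.castRingHom ℝ) ∘ q) G M where
  perfect := hperf
  sep := hsep.isSeparated
  slot_sep s x y hxy := by
    refine strictlySep_of_orient_mul_pos (mul_self_pos.2 ?_)
    simp only [Function.comp_apply, orient_map]
    exact Int.cast_ne_zero.2 (hslot x y hxy s)
  blocked s t hst := by
    obtain ⟨x, y, hxy, hcross⟩ := hblocked s t hst
    exact ⟨x, y, hxy, hcross.map Int.cast_strictMono⟩

/-- There is a skeleton with `l` slots that consists of a `d`-regular graph and a perfect matching
of `m` edges. -/
def HasSkeleton (d m l : ℕ) : Prop :=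
  ∃ (r : Fin (2 * m) → ℝ × ℝ) (q : Fin l → ℝ × ℝ) (G M : SimpleGraph (Fin (2 * m))),
    IsMatchedGraph G M d m ∧ IsSkeleton r q G M

/-- There is a blocked drawing of a `d`-regular graph on `n` vertices and a matching of `m`
edges. -/
def HasBlockedDrawing (d n m : ℕ) : Prop :=
  ∃ (p : Fin n → ℝ × ℝ) (G M : SimpleGraph (Fin n)), IsMatchedGraph G M d m ∧ IsBlockedDrawing p G M

lemma IsBlockedDrawing.hasBlockedDrawing [Fintype V] (h : IsBlockedDrawing p G M)
    (hM : IsMatchedGraph G M d m) (hn : Fintype.card V = n) : HasBlockedDrawing d n m :=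
  let e := (Fintype.equivFinOfCardEq hn).symm
  ⟨_, _, _, hM.comap_equiv e, h.comap_equiv e⟩

-- All vertices of a complete graph may be placed at one point, since no two of them have to be
-- blocked; with at most three vertices no two edges are disjoint.
lemma hasBlockedDrawing_top (hd : d ≤ 2) : HasBlockedDrawing d (d + 1) 0 := by
  refine ⟨0, ⊤, ⊥, isMatchedGraph_top d, ?_, fun u v huv _ _ hadj => absurd huv hadj⟩
  intro u v x y huv hxy hux huy hvx hvy
  have := huv.ne
  have := hxy.ne
  omega

lemma HasSkeleton.hasBlockedDrawing (h₀ : HasSkeleton d m₀ l) (h : HasBlockedDrawing d n m) :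
    HasBlockedDrawing d (2 * m₀ + l * n) (m₀ + l * m) := by
  obtain ⟨r, q, G₀, M₀, hM₀, h₀⟩ := h₀
  obtain ⟨p, G, M, hM, h⟩ := h
  obtain ⟨P, hP⟩ := h₀.exists_isBlockedDrawing_sum h
  have hsum := hM₀.sum (hM.bot_boxProd (Fin l))
  rw [Nat.card_eq_fintype_card, Fintype.card_fin] at hsum
  exact hP.hasBlockedDrawing hsum (by simp)

lemma HasSkeleton.exists_le_hasBlockedDrawing (h₀ : HasSkeleton d m₀ l) (hd : d ≤ 2) (hm₀ : 0 < m₀)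
    (hl : 0 < l) (hbalanced : 2 * m₀ + l * (d + 1) = c * m₀ + (d + 1)) (k : ℕ) :
    ∃ m, k ≤ m ∧ HasBlockedDrawing d (c * m + (d + 1)) m := by
  induction k with
  | zero => exact ⟨0, le_rfl, by simpa using hasBlockedDrawing_top hd⟩
  | succ k ih =>
    obtain ⟨m, hkm, h⟩ := ih
    have hcard : 2 * m₀ + l * (c * m + (d + 1)) = c * (m₀ + l * m) + (d + 1) := by
      linear_combination hbalanced
    refine ⟨m₀ + l * m, ?_, hcard ▸ h₀.hasBlockedDrawing h⟩
    have := Nat.le_mul_of_pos_left m hl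
    omega

lemma HasSkeleton.infinite_setOf_tight (h₀ : HasSkeleton d m₀ l) (hd : d ≤ 2) (hm₀ : 0 < m₀)
    (hl : 0 < l) (hc : 0 < c) (hbalanced : 2 * m₀ + l * (d + 1) = c * m₀ + (d + 1))
    (hlower : ∀ n (Γ : GeometricGraph (Fin n)), Γ.IsRegular d → n ≤ c * Γ.mm + (d + 1)) :
    {n : ℕ | ∃ Γ : GeometricGraph (Fin n),
      Γ.IsRegular d ∧ (Γ.mm : ℝ) = ((n : ℝ) - (d + 1 : ℕ)) / c}.Infinite := by
  refine infinite_of_forall_exists_gt fun a => ?_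
  obtain ⟨m, ham, p, G, M, hM, h⟩ := h₀.exists_le_hasBlockedDrawing hd hm₀ hl hbalanced a
  obtain ⟨Γ, hreg, hmm⟩ := h.exists_geometricGraph hM
  have hmm : Γ.mm = m := hmm.antisymm <|
    Nat.le_of_mul_le_mul_left (Nat.le_of_add_le_add_right (hlower _ Γ hreg)) hc
  refine ⟨c * m + (d + 1), ⟨Γ, hreg, ?_⟩, ?_⟩
  · rw [hmm, Nat.cast_add, add_sub_cancel_right, Nat.cast_mul,
      mul_div_cancel_left₀ _ (Nat.cast_ne_zero.2 hc.ne')]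
  · have := Nat.le_mul_of_pos_left m hc
    omega

lemma hasSkeleton_of_int {r : Fin (2 * m) → ℤ × ℤ} {q : Fin l → ℤ × ℤ}
    (G M : SimpleGraph (Fin (2 * m))) [DecidableRel G.Adj] (hreg : ∀ v, G.degree v = d)
    (hmatching : ∀ v a b, M.Adj v a → M.Adj v b → a = b) (hdisj : ∀ u v, G.Adj u v → ¬ M.Adj u v)
    (hperf : ∀ v, ∃ w, M.Adj v w)
    (hsep : IsLineSeparated r (G ⊔ M))
    (hslot : ∀ x y, (G ⊔ M).Adj x y → ∀ s, orient (r x) (r y) (q s) ≠ 0)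
    (hblocked : ∀ s t, s ≠ t →
      ∃ x y, (G ⊔ M).Adj x y ∧ Crosses (q s) (q t) (r x) (r y)) :
    HasSkeleton d m l :=
  have hsupport : M.support = univ := eq_univ_of_forall hperf
  ⟨_, _, G, M, isMatchedGraph_of_degree_eq hreg hmatching
    (disjoint_iff_forall_adj.2 hdisj) hsupport (Fintype.card_fin _),
    isSkeleton_of_int hsupport hsep hslot hblocked⟩

-- A single segment with a slot on either side.
lemma hasSkeleton_zero : HasSkeleton 0 1 2 :=
  hasSkeleton_of_int (r := ![(0, -1), (0, 1)]) (q := ![(-1, 0), (1, 0)]) ⊥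
    (.fromEdgeSet ({s(0, 1)} : Finset (Sym2 (Fin 2))))
    (by decide +kernel) (by decide +kernel) (by decide +kernel) (by decide +kernel)
    (by decide +kernel) (by decide +kernel) (by decide +kernel)

-- A square whose sides alternate between graph and matching, with a slot in the centre and one
-- outside close to each side.
lemma hasSkeleton_one : HasSkeleton 1 2 5 :=
  hasSkeleton_of_int (r := ![(0, 0), (10, 0), (10, 10), (0, 10)])
    (q := ![(5, 5), (5, -1), (11, 5), (5, 11), (-1, 5)])
    (.fromEdgeSet ({s(0, 1), s(2, 3)} : Finset (Sym2 (Fin 4))))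
    (.fromEdgeSet ({s(1, 2), s(3, 0)} : Finset (Sym2 (Fin 4))))
    (by decide +kernel) (by decide +kernel) (by decide +kernel) (by decide +kernel)
    (by decide +kernel) (by decide +kernel) (by decide +kernel)

-- Two nested triangles joined by three twisted matching edges, such that every vertex has a reflex
-- angle, with ten slots.
lemma hasSkeleton_two : HasSkeleton 2 3 10 :=
  hasSkeleton_of_int (r := ![(-14, 12), (-3, -18), (17, 6), (0, 4), (-3, -2), (3, -2)])
    (q := ![(0, 0), (-9, -3), (8, -7), (2, 10), (-7, 9), (2, 1), (-4, -10), (-2, 1), (11, 1),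
      (0, -3)])
    (.fromEdgeSet ({s(0, 1), s(1, 2), s(2, 0), s(3, 4), s(4, 5), s(5, 3)} :
      Finset (Sym2 (Fin 6))))
    (.fromEdgeSet ({s(0, 3), s(1, 4), s(2, 5)} : Finset (Sym2 (Fin 6))))
    (by decide +kernel) (by decide +kernel) (by decide +kernel) (by decide +kernel)
    (by decide +kernel) (by decide +kernel) (by decide +kernel)

end Tightness

theorem theorem2 :
    (∀ (V : Type*) [Fintype V] (G : GeometricGraph V),
      (G.IsRegular 0 → ((Fintype.card V : ℝ) - 1) / 3 ≤ (G.mm : ℝ)) ∧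
      (G.IsRegular 1 → ((Fintype.card V : ℝ) - 2) / 6 ≤ (G.mm : ℝ)) ∧
      (G.IsRegular 2 → ((Fintype.card V : ℝ) - 3) / 11 ≤ (G.mm : ℝ))) ∧
    {n : ℕ | ∃ G : GeometricGraph (Fin n),
      G.IsRegular 0 ∧ (G.mm : ℝ) = ((n : ℝ) - 1) / 3}.Infinite ∧
    {n : ℕ | ∃ G : GeometricGraph (Fin n),
      G.IsRegular 1 ∧ (G.mm : ℝ) = ((n : ℝ) - 2) / 6}.Infinite ∧
    {n : ℕ | ∃ G : GeometricGraph (Fin n),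
      G.IsRegular 2 ∧ (G.mm : ℝ) = ((n : ℝ) - 3) / 11}.Infinite := by
  refine ⟨fun V _ G => ⟨fun hG => ?_, fun hG => ?_, fun hG => ?_⟩, ?_, ?_, ?_⟩
  · have hlower : (Fintype.card V : ℝ) ≤ 3 * G.mm + 1 :=
      mod_cast G.card_le_of_isRegular_zero hG
    linarith
  · have hlower : (Fintype.card V : ℝ) ≤ 6 * G.mm + 2 :=
      mod_cast G.card_le_of_isRegular_one hG
    linarith
  · have hlower : (Fintype.card V : ℝ) ≤ 11 * G.mm + 3 :=
      mod_cast G.card_le_of_isRegular_two hG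
    linarith
  · simpa using hasSkeleton_zero.infinite_setOf_tight (by simp) one_pos two_pos three_pos rfl
      fun n Γ hΓ => by simpa using Γ.card_le_of_isRegular_zero hΓ
  · simpa using hasSkeleton_one.infinite_setOf_tight (c := 6) (by simp) (by simp) (by simp)
      (by simp) rfl fun n Γ hΓ => by simpa using Γ.card_le_of_isRegular_one hΓ
  · simpa using hasSkeleton_two.infinite_setOf_tight (c := 11) (by simp) (by simp) (by simp)
      (by simp) rfl fun n Γ hΓ => by simpa using Γ.card_le_of_isRegular_two hΓ
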